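/- Let $V$ be a real vector space and $C\subseteq V$ a cone, i.e. $C$ is convex, $\lambda C\subseteq C$ for all $\lambda\ge 0$, and $C\cap(-C)=\{0\}$. Write $x\le_C y$ if $y-x\in C$. Suppose that $(V,C,u)$ is an order unit space: $C$ is Archimedean (if $x\in V$, $y\in C$ and $nx\le_C y$ for all $n=1,2,\dots$, then $x\le_C 0$), and $u\in C$ is an order unit (for each $x\in V$ there is $\lambda\ge 0$ with $x\le_C\lambda u$). Equip $V$ with the order unit norm $$\|x\|_u=\inf\{\lambda>0:\ -\lambda u\le_C x\le_C\lambda u\},$$ and let $C^\circ$ and $\partial C$ denote the interior and the boundary of $C$ in the norm topology. Assume that $V$ is complete with respect to $\|\cdot\|_u$, that $C$ is strictly convex (for all linearly independent $x,y\in\partial C$ the segment $\{(1-t)x+ty: 0<t<1\}$ is contained in $C^\circ$), and that $\dim V\ge 3$. **Theorem.** The following are equivalent. 1. There exists a bijective map $g\colon C^\circ\to C^\circ$ which is antihomogeneous, i.e. $g(\lambda x)=\lambda^{-1}g(x)$ for all $\lambda>0$ and $x\in C^\circ$, and an order-antimorphism, i.e. $x\le_C y$ if and only if $g(y)\le_C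 g(x)$, for all $x,y\in C^\circ$. 2. $(V,C,u)$ is a spin factor: $\dim V\ge 3$, and there is a real Hilbert space $(H,(\cdot\mid\cdot))$ with norm $\|\cdot\|_2$ such that, up to a linear identification, $V=H\oplus\mathbb{R}u$ (vector space direct sum), $\|x+\beta u\|_u=\|x\|_2+|\beta|$ for all $x\in H$ and $\beta\in\mathbb{R}$, and $C=\{a\circ a: a\in V\}$, where $\circ$ is the Jordan product $$(a+\alpha u)\circ(b+\beta u)=\beta a+\alpha b+\big((a\mid b)+\alpha\beta\big)u\qquad(a,b\in H,\ \alpha,\beta\in\mathbb{R}).$$ -/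

import Mathlib

open scoped InnerProductSpace

universe u

/-- An order unit space structure `(V, C, u)` on a real vector space `V`: a cone `C` (convex, closed
under multiplication by nonnegative scalars, with `C ∩ -C = {0}`) which is Archimedean, together
with an order unit `u ∈ C`. The order is `x ≤_C y ↔ y - x ∈ C`. -/
structure OrderUnitSpace (V : Type u) [AddCommGroup V] [Module ℝ V] where
  /-- The cone `C`. -/
  cone : PointedCone ℝ V
  /-- The order unit `u`. -/
  unit : V
  salient : ∀ x ∈ cone, -x ∈ cone → x = 0
  archimedean : ∀ x : V, ∀ y ∈ cone, (∀ n : ℕ, 1 ≤ n → y - n • x ∈ cone) → 0 - x ∈ cone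
  unit_mem : unit ∈ cone
  unit_dominates : ∀ x : V, ∃ r : ℝ, 0 ≤ r ∧ r • unit - x ∈ cone

namespace OrderUnitSpace

variable {V : Type u} [AddCommGroup V] [Module ℝ V]

/-- The partial order `x ≤_C y` induced by the cone. -/
def LE (S : OrderUnitSpace V) (x y : V) : Prop := y - x ∈ S.cone

/-- The order unit norm `‖x‖_u = inf {r > 0 : -r u ≤_C x ≤_C r u}`. -/
noncomputable def unitNorm (S : OrderUnitSpace V) (x : V) : ℝ :=
  sInf {r : ℝ | 0 < r ∧ S.LE (-(r • S.unit)) x ∧ S.LE x (r • S.unit)}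

theorem smul_mem_cone (S : OrderUnitSpace V) {r : ℝ} (hr : 0 ≤ r) {x : V} (hx : x ∈ S.cone) :
    r • x ∈ S.cone :=
  S.cone.smul_mem hr hx

theorem exists_bound (S : OrderUnitSpace V) (x : V) :
    ∃ r : ℝ, 0 < r ∧ S.LE (-(r • S.unit)) x ∧ S.LE x (r • S.unit) := by
  obtain ⟨a, ha, hax⟩ := S.unit_dominates x
  obtain ⟨b, hb, hbx⟩ := S.unit_dominates (-x)
  refine ⟨a + b + 1, by positivity, ?_, ?_⟩
  · have h := S.cone.add_mem hbx (S.smul_mem_cone (r := a + 1) (by positivity) S.unit_mem)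
    have e : x - -((a + b + 1) • S.unit) = b • S.unit - -x + (a + 1) • S.unit := by module
    rw [LE, e]; exact h
  · have h := S.cone.add_mem hax (S.smul_mem_cone (r := b + 1) (by positivity) S.unit_mem)
    have e : (a + b + 1) • S.unit - x = a • S.unit - x + (b + 1) • S.unit := by module
    rw [LE, e]; exact h

theorem bddBelow_bounds (S : OrderUnitSpace V) (x : V) :
    BddBelow {r : ℝ | 0 < r ∧ S.LE (-(r • S.unit)) x ∧ S.LE x (r • S.unit)} :=
  ⟨0, fun _ hr => hr.1.le⟩

theorem unitNorm_nonneg (S : OrderUnitSpace V) (x : V) : 0 ≤ S.unitNorm x :=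
  Real.sInf_nonneg fun _ hr => hr.1.le

theorem unitNorm_le (S : OrderUnitSpace V) {x : V} {r : ℝ} (hr : 0 < r)
    (h₁ : S.LE (-(r • S.unit)) x) (h₂ : S.LE x (r • S.unit)) : S.unitNorm x ≤ r :=
  csInf_le (S.bddBelow_bounds x) ⟨hr, h₁, h₂⟩

theorem bounds_of_unitNorm_lt (S : OrderUnitSpace V) {x : V} {r : ℝ} (h : S.unitNorm x < r) :
    S.LE (-(r • S.unit)) x ∧ S.LE x (r • S.unit) := by
  obtain ⟨t, ⟨_, h₁, h₂⟩, htr⟩ := exists_lt_of_csInf_lt (S.exists_bound x) h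
  have hu := S.smul_mem_cone (sub_nonneg.2 htr.le) S.unit_mem
  constructor
  · have e : x - -(r • S.unit) = (x - -(t • S.unit)) + (r - t) • S.unit := by module
    rw [LE, e]; exact S.cone.add_mem h₁ hu
  · have e : r • S.unit - x = (t • S.unit - x) + (r - t) • S.unit := by module
    rw [LE, e]; exact S.cone.add_mem h₂ hu

theorem unitNorm_add_le (S : OrderUnitSpace V) (x y : V) :
    S.unitNorm (x + y) ≤ S.unitNorm x + S.unitNorm y := by
  refine le_of_forall_pos_le_add fun ε hε => ?_
  obtain ⟨a₁, a₂⟩ := S.bounds_of_unitNorm_lt (x := x) (r := S.unitNorm x + ε / 2) (by linarith)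
  obtain ⟨b₁, b₂⟩ := S.bounds_of_unitNorm_lt (x := y) (r := S.unitNorm y + ε / 2) (by linarith)
  have hx := S.unitNorm_nonneg x
  have hy := S.unitNorm_nonneg y
  refine S.unitNorm_le (by positivity) ?_ ?_
  · have e : x + y - -((S.unitNorm x + S.unitNorm y + ε) • S.unit) =
        (x - -((S.unitNorm x + ε / 2) • S.unit)) + (y - -((S.unitNorm y + ε / 2) • S.unit)) := by
      module
    rw [LE, e]; exact S.cone.add_mem a₁ b₁
  · have e : (S.unitNorm x + S.unitNorm y + ε) • S.unit - (x + y) =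
        ((S.unitNorm x + ε / 2) • S.unit - x) + ((S.unitNorm y + ε / 2) • S.unit - y) := by
      module
    rw [LE, e]; exact S.cone.add_mem a₂ b₂

theorem unitNorm_zero (S : OrderUnitSpace V) : S.unitNorm (0 : V) = 0 := by
  refine le_antisymm (le_of_forall_pos_le_add fun ε hε => ?_) (S.unitNorm_nonneg 0)
  have h := S.smul_mem_cone hε.le S.unit_mem
  rw [zero_add]
  exact S.unitNorm_le hε (by simpa [LE] using h) (by simpa [LE] using h)

theorem unitNorm_smul_le (S : OrderUnitSpace V) (c : ℝ) (x : V) :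
    S.unitNorm (c • x) ≤ |c| * S.unitNorm x := by
  rcases eq_or_ne c 0 with rfl | hc
  · simp [unitNorm_zero]
  have hc' : 0 < |c| := abs_pos.2 hc
  refine le_of_forall_pos_le_add fun ε hε => ?_
  have hx := S.unitNorm_nonneg x
  have hs : |c| * (S.unitNorm x + ε / |c|) = |c| * S.unitNorm x + ε := by field_simp
  obtain ⟨a₁, a₂⟩ := S.bounds_of_unitNorm_lt (x := x) (r := S.unitNorm x + ε / |c|)
    (by linarith [div_pos hε hc'])
  have b₁ := S.smul_mem_cone hc'.le a₁
  have b₂ := S.smul_mem_cone hc'.le a₂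
  rw [← hs]
  refine S.unitNorm_le (by positivity) ?_ ?_ <;>
    rcases abs_choice c with h | h <;> rw [h] at b₁ b₂ ⊢ <;> unfold LE
  · convert b₁ using 1; module
  · convert b₂ using 1; module
  · convert b₂ using 1; module
  · convert b₁ using 1; module

theorem unitNorm_smul (S : OrderUnitSpace V) (c : ℝ) (x : V) :
    S.unitNorm (c • x) = |c| * S.unitNorm x := by
  refine le_antisymm (S.unitNorm_smul_le c x) ?_
  rcases eq_or_ne c 0 with rfl | hc
  · simp [unitNorm_zero]
  have h := S.unitNorm_smul_le c⁻¹ (c • x)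
  rw [inv_smul_smul₀ hc, abs_inv] at h
  have hc' : 0 < |c| := abs_pos.2 hc
  calc |c| * S.unitNorm x ≤ |c| * (|c|⁻¹ * S.unitNorm (c • x)) := by gcongr
    _ = S.unitNorm (c • x) := by field_simp

theorem eq_zero_of_unitNorm (S : OrderUnitSpace V) {x : V} (h : S.unitNorm x = 0) : x = 0 := by
  have key : ∀ z : V, S.unitNorm z = 0 → 0 - z ∈ S.cone := fun z hz => by
    refine S.archimedean z S.unit S.unit_mem fun n hn => ?_
    have hn' : (0 : ℝ) < n := by exact_mod_cast hn
    have hb := (S.bounds_of_unitNorm_lt (x := z) (r := (n : ℝ)⁻¹) (by rw [hz]; positivity)).2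
    have := S.smul_mem_cone hn'.le hb
    rwa [smul_sub, smul_inv_smul₀ hn'.ne', Nat.cast_smul_eq_nsmul] at this
  have h₁ := key x h
  have h₂ := key (-x) (by
    have := S.unitNorm_smul (-1) x
    simpa [h] using this)
  exact S.salient x (by simpa using h₂) (by simpa using h₁)

/-- `V` as a normed group, with the order unit norm. -/
noncomputable abbrev normedAddCommGroup (S : OrderUnitSpace V) : NormedAddCommGroup V :=
  letI : Norm V := ⟨S.unitNorm⟩
  NormedAddCommGroup.ofCore (𝕜 := ℝ)
    { norm_nonneg := S.unitNorm_nonneg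
      norm_smul := S.unitNorm_smul
      norm_triangle := S.unitNorm_add_le
      norm_eq_zero_iff := fun _ =>
        ⟨S.eq_zero_of_unitNorm, fun h => by rw [h]; exact S.unitNorm_zero⟩ }

/-- `V` as a real normed space, with the order unit norm. -/
noncomputable abbrev normedSpace (S : OrderUnitSpace V) :
    @NormedSpace ℝ V _ S.normedAddCommGroup.toSeminormedAddCommGroup :=
  letI := S.normedAddCommGroup
  { norm_smul_le := fun c x => (S.unitNorm_smul c x).le }

/-- Completeness of `V` with respect to the order unit norm. -/
def IsComplete (S : OrderUnitSpace V) : Prop :=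
  letI := S.normedAddCommGroup
  CompleteSpace V

/-- The interior `C°` of the cone in the order unit norm topology. -/
def interiorCone (S : OrderUnitSpace V) : Set V :=
  letI := S.normedAddCommGroup
  interior (S.cone : Set V)

/-- The boundary `∂C` of the cone in the order unit norm topology. -/
def boundaryCone (S : OrderUnitSpace V) : Set V :=
  letI := S.normedAddCommGroup
  frontier (S.cone : Set V)

/-- The cone is strictly convex: for linearly independent `x, y ∈ ∂C`, the open segment
`{(1 - t) x + t y : 0 < t < 1}` is contained in `C°`. -/
def StrictlyConvexCone (S : OrderUnitSpace V) : Prop :=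
  ∀ x ∈ S.boundaryCone, ∀ y ∈ S.boundaryCone, LinearIndependent ℝ ![x, y] →
    ∀ t : ℝ, 0 < t → t < 1 → (1 - t) • x + t • y ∈ S.interiorCone

theorem smul_mem_interiorCone (S : OrderUnitSpace V) {r : ℝ} (hr : 0 < r) {x : V}
    (hx : x ∈ S.interiorCone) : r • x ∈ S.interiorCone := by
  let := S.normedAddCommGroup
  let := S.normedSpace
  have hsub : (fun y : V => r • y) '' interior (S.cone : Set V) ⊆ interior (S.cone : Set V) := by
    refine interior_maximal ?_ (isOpenMap_smul₀ hr.ne' _ isOpen_interior)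
    rintro _ ⟨y, hy, rfl⟩
    exact S.smul_mem_cone hr.le (interior_subset hy)
  exact hsub ⟨x, hx, rfl⟩

/-- `g : C° → C°` is antihomogeneous: `g (r x) = r⁻¹ g x` for all `r > 0`. -/
def Antihomogeneous (S : OrderUnitSpace V) (g : S.interiorCone → S.interiorCone) : Prop :=
  ∀ (r : ℝ) (hr : 0 < r) (x : S.interiorCone),
    (g ⟨r • (x : V), S.smul_mem_interiorCone hr x.2⟩ : V) = r⁻¹ • (g x : V)

/-- `g : C° → C°` is an order-antimorphism: `x ≤_C y ↔ g y ≤_C g x`. -/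
def OrderAntimorphism (S : OrderUnitSpace V) (g : S.interiorCone → S.interiorCone) : Prop :=
  ∀ x y : S.interiorCone, S.LE (x : V) (y : V) ↔ S.LE (g y : V) (g x : V)

end OrderUnitSpace

section Spin

variable {H : Type u} [NormedAddCommGroup H] [InnerProductSpace ℝ H]

/-- The Jordan product on `H ⊕ ℝ e`, where `(a, α)` stands for `a + α e`:
`(a + α e) ∘ (b + β e) = β a + α b + (⟪a, b⟫ + α β) e`. -/
noncomputable def spinMul (x y : H × ℝ) : H × ℝ :=
  (y.2 • x.1 + x.2 • y.1, ⟪x.1, y.1⟫_ℝ + x.2 * y.2)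

/-- The spin factor norm `‖a + α e‖ = ‖a‖₂ + |α|` on `H ⊕ ℝ e`. -/
noncomputable def spinNorm (x : H × ℝ) : ℝ := ‖x.1‖ + |x.2|

end Spin

/-- `(V, C, u)` is a spin factor: `dim V ≥ 3` and there are a real Hilbert space `H` and a linear
identification of `V` with `H ⊕ ℝ e` under which the order unit is `e`, the order unit norm is the
spin factor norm, and the cone is the set of squares for the spin factor Jordan product. -/
def OrderUnitSpace.IsSpinFactor {V : Type u} [AddCommGroup V] [Module ℝ V]
    (S : OrderUnitSpace V) : Prop :=
  3 ≤ Module.rank ℝ V ∧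
  ∃ (H : Type u) (_ : NormedAddCommGroup H) (_ : InnerProductSpace ℝ H) (_ : CompleteSpace H)
    (T : V ≃ₗ[ℝ] H × ℝ),
    T S.unit = (0, 1) ∧
    (∀ v : V, S.unitNorm v = spinNorm (T v)) ∧
    T '' (S.cone : Set V) = {b : H × ℝ | ∃ a : H × ℝ, spinMul a a = b}

/-!
Write `u` for the order unit and `x ≤ y` for the cone order.

Let `G` be an antihomogeneous order-antimorphism of the interior of the cone. It carries pairs with
`y - x` on the boundary to pairs with `G x - G y` on the boundary. By strict convexity, two boundary
vectors whose sum is on the boundary are parallel, so `G` maps the points `r + t s` (with `r`, `s`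
boundary vectors whose sum is interior) to a line. Applying this with `r` and `s` exchanged gives
the slice formula `G (a r + b s) = a⁻¹ r' + b⁻¹ s'` (`IsInversion.exists_slice`).

The formula gives second order expansions `G (x + t v) = G x - t T + t² Q + O(t³)` with remainders
that are uniform in `x` near `u`. Comparing difference quotients based at `u + t v` in the direction
`w` with those based at `u` shows that `T` is linear in `v` at `u` (`IsInversion.expansion_add`)
and that `Q` satisfies the parallelogram law (`IsInversion.expansion_parallelogram`). Since `T` is
injective and carries the spectral square of `v` to `Q`, the square also satisfies this law
(`IsInversion.square_parallelogram`). As the square of `v` is a combination of `v` and `u`, its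
coefficient along `v`, which is twice the half trace, is linear in `v` (`halfTrace_add`). On the
kernel of the half trace the square of `v` is `‖v‖² u`, so there the order unit norm satisfies the
parallelogram law and comes from an inner product. This kernel is the Hilbert space of the spin
factor (`isSpinFactor_of_square_parallelogram`).

Conversely, the Jordan inverse of a spin factor reverses the order (`norm_spinInv_sub_le`).
-/

namespace OrderUnitSpace

variable {V : Type u} [AddCommGroup V] [Module ℝ V] (S : OrderUnitSpace V)

/-! ### The cone, its interior and its boundary -/

theorem mem_of_sub_mem {x y : V} (hx : x ∈ S.cone) (h : y - x ∈ S.cone) : y ∈ S.cone := by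
  simpa using S.cone.add_mem hx h

/-- The Archimedean property in the form of closedness along rays. -/
theorem mem_of_forall_add_smul_mem {x e : V} (he : e ∈ S.cone)
    (h : ∀ ε : ℝ, 0 < ε → x + ε • e ∈ S.cone) : x ∈ S.cone := by
  have := S.archimedean (-x) e he fun n hn => by
    have hn' : (0 : ℝ) < n := by exact_mod_cast hn
    have := S.smul_mem_cone hn'.le (h (n : ℝ)⁻¹ (by positivity))
    rw [smul_add, smul_inv_smul₀ hn'.ne', Nat.cast_smul_eq_nsmul] at this
    rwa [smul_neg, sub_neg_eq_add, add_comm]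
  simpa using this

theorem mem_interiorCone_iff {x : V} :
    x ∈ S.interiorCone ↔ ∃ ε : ℝ, 0 < ε ∧ x - ε • S.unit ∈ S.cone := by
  let := S.normedAddCommGroup
  let := S.normedSpace
  have hI : x ∈ S.interiorCone ↔ x ∈ interior (S.cone : Set V) := Iff.rfl
  rw [hI, mem_interior_iff_mem_nhds, Metric.mem_nhds_iff]
  constructor
  · rintro ⟨δ, hδ, h⟩
    have hu : 0 < ‖S.unit‖ + 1 := by positivity
    refine ⟨δ / 2 / (‖S.unit‖ + 1), by positivity, h ?_⟩
    rw [mem_ball_iff_norm, sub_sub_cancel_left, norm_neg, norm_smul, Real.norm_eq_abs,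
      abs_of_pos (by positivity), div_mul_eq_mul_div, div_lt_iff₀ hu]
    nlinarith [norm_nonneg S.unit]
  · rintro ⟨ε, hε, h⟩
    refine ⟨ε, hε, fun y hy => ?_⟩
    have hy' : S.unitNorm (y - x) < ε := by
      rw [mem_ball_iff_norm] at hy
      exact hy
    have := S.cone.add_mem h (S.bounds_of_unitNorm_lt hy').1
    have e : x - ε • S.unit + (y - x - -(ε • S.unit)) = y := by module
    rwa [e] at this

theorem mem_cone_of_mem_interiorCone {x : V} (hx : x ∈ S.interiorCone) : x ∈ S.cone := by
  obtain ⟨ε, hε, h⟩ := S.mem_interiorCone_iff.1 hx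
  exact S.mem_of_sub_mem (S.smul_mem_cone hε.le S.unit_mem) h

theorem mem_boundaryCone_iff {x : V} :
    x ∈ S.boundaryCone ↔ x ∈ S.cone ∧ x ∉ S.interiorCone := by
  let := S.normedAddCommGroup
  let := S.normedSpace
  have hB : x ∈ S.boundaryCone ↔ x ∈ closure (S.cone : Set V) ∧ x ∉ S.interiorCone := Iff.rfl
  rw [hB]
  refine and_congr_left fun _ => ⟨fun h => ?_, fun h => subset_closure h⟩
  refine S.mem_of_forall_add_smul_mem S.unit_mem fun ε hε => ?_
  obtain ⟨y, hy, hyx⟩ := Metric.mem_closure_iff.1 h ε hε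
  have hn : S.unitNorm (x - y) < ε := by
    rw [dist_eq_norm] at hyx
    exact hyx
  have := S.cone.add_mem hy (S.bounds_of_unitNorm_lt hn).1
  have e : y + (x - y - -(ε • S.unit)) = x + ε • S.unit := by module
  rwa [e] at this

theorem unit_mem_interiorCone : S.unit ∈ S.interiorCone :=
  S.mem_interiorCone_iff.2 ⟨1, one_pos, by simp⟩

/-- Every interior point of the cone is an order unit. -/
theorem exists_smul_sub_mem {x : V} (hx : x ∈ S.interiorCone) (v : V) :
    ∃ r : ℝ, 0 < r ∧ r • x - v ∈ S.cone := by
  obtain ⟨ε, hε, h⟩ := S.mem_interiorCone_iff.1 hx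
  obtain ⟨r, hr, _, hv⟩ := S.exists_bound v
  refine ⟨r / ε, by positivity, ?_⟩
  have := S.cone.add_mem (S.smul_mem_cone (r := r / ε) (by positivity) h) hv
  have e : (r / ε) • (x - ε • S.unit) + (r • S.unit - v) = (r / ε) • x - v := by
    match_scalars <;> field_simp <;> ring
  rwa [e] at this

theorem mem_interiorCone_iff_of_mem {x y : V} (hx : x ∈ S.interiorCone) :
    y ∈ S.interiorCone ↔ ∃ ε : ℝ, 0 < ε ∧ y - ε • x ∈ S.cone := by
  constructor
  · intro hy
    obtain ⟨r, hr, h⟩ := S.exists_smul_sub_mem hy x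
    refine ⟨r⁻¹, by positivity, ?_⟩
    have := S.smul_mem_cone (inv_nonneg.2 hr.le) h
    rwa [smul_sub, inv_smul_smul₀ hr.ne'] at this
  · rintro ⟨ε, hε, h⟩
    obtain ⟨δ, hδ, h'⟩ := S.mem_interiorCone_iff.1 hx
    refine S.mem_interiorCone_iff.2 ⟨ε * δ, by positivity, ?_⟩
    have := S.cone.add_mem h (S.smul_mem_cone hε.le h')
    have e : y - ε • x + ε • (x - δ • S.unit) = y - (ε * δ) • S.unit := by module
    rwa [e] at this

theorem smul_mem_interiorCone_iff {r : ℝ} (hr : 0 < r) {x : V} :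
    r • x ∈ S.interiorCone ↔ x ∈ S.interiorCone := by
  refine ⟨fun h => ?_, S.smul_mem_interiorCone hr⟩
  simpa [smul_smul, inv_mul_cancel₀ hr.ne'] using S.smul_mem_interiorCone (inv_pos.2 hr) h

theorem smul_add_smul_mem_interiorCone {r s : V} (hr : r ∈ S.cone) (hs : s ∈ S.cone)
    (hrs : r + s ∈ S.interiorCone) {a b : ℝ} (ha : 0 < a) (hb : 0 < b) :
    a • r + b • s ∈ S.interiorCone := by
  refine (S.mem_interiorCone_iff_of_mem hrs).2 ⟨min a b, lt_min ha hb, ?_⟩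
  have := S.cone.add_mem (S.smul_mem_cone (sub_nonneg.2 (min_le_left a b)) hr)
    (S.smul_mem_cone (sub_nonneg.2 (min_le_right a b)) hs)
  convert this using 1
  module

/-- Strict convexity: boundary vectors whose sum is again a boundary vector are dependent. -/
theorem StrictlyConvexCone.exists_smul_add_smul_eq_zero {S : OrderUnitSpace V}
    (hS : S.StrictlyConvexCone) {p q : V} (hp : p ∈ S.boundaryCone) (hq : q ∈ S.boundaryCone)
    (hpq : p + q ∈ S.boundaryCone) : ∃ a b : ℝ, a • p + b • q = 0 ∧ ¬(a = 0 ∧ b = 0) := by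
  by_contra! h
  have hli : LinearIndependent ℝ ![p, q] :=
    LinearIndependent.pair_iff.2 fun a b hab => h a b hab
  have := hS p hp q hq hli (1 / 2) (by norm_num) (by norm_num)
  have e : (1 - 1 / 2 : ℝ) • p + (1 / 2 : ℝ) • q = (1 / 2 : ℝ) • (p + q) := by module
  rw [e, S.smul_mem_interiorCone_iff (by norm_num)] at this
  exact (S.mem_boundaryCone_iff.1 hpq).2 this

theorem unitNorm_le_iff {v : V} {r : ℝ} (hr : 0 ≤ r) :
    S.unitNorm v ≤ r ↔ r • S.unit - v ∈ S.cone ∧ v + r • S.unit ∈ S.cone := by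
  constructor
  · intro h
    constructor <;> refine S.mem_of_forall_add_smul_mem S.unit_mem fun ε hε => ?_
    · have := (S.bounds_of_unitNorm_lt (x := v) (r := r + ε) (by linarith)).2
      rw [LE] at this
      convert this using 1; module
    · have := (S.bounds_of_unitNorm_lt (x := v) (r := r + ε) (by linarith)).1
      rw [LE] at this
      convert this using 1; module
  · rintro ⟨h₁, h₂⟩
    refine le_of_forall_pos_le_add fun ε hε => S.unitNorm_le (by positivity) ?_ ?_
    · rw [LE]
      convert S.cone.add_mem h₂ (S.smul_mem_cone hε.le S.unit_mem) using 1; module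
    · rw [LE]
      convert S.cone.add_mem h₁ (S.smul_mem_cone hε.le S.unit_mem) using 1; module

theorem unitNorm_le_unitNorm {x y : V} (hx : x ∈ S.cone) (h : y - x ∈ S.cone) :
    S.unitNorm x ≤ S.unitNorm y := by
  have hy := S.unitNorm_nonneg y
  refine (S.unitNorm_le_iff hy).2 ⟨?_, S.cone.add_mem hx (S.smul_mem_cone hy S.unit_mem)⟩
  convert S.cone.add_mem h ((S.unitNorm_le_iff hy).1 le_rfl).1 using 1; module

theorem neg_notMem_of_mem_interiorCone [Nontrivial V] {x : V} (hx : x ∈ S.interiorCone) :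
    -x ∉ S.cone := by
  intro hn
  have h0 : x = 0 := S.salient x (S.mem_cone_of_mem_interiorCone hx) hn
  subst h0
  obtain ⟨v, hv⟩ := exists_ne (0 : V)
  obtain ⟨r, _, h⟩ := S.exists_smul_sub_mem hx v
  obtain ⟨r', _, h'⟩ := S.exists_smul_sub_mem hx (-v)
  exact hv (S.salient v (by simpa using h') (by simpa using h))

theorem zero_notMem_interiorCone [Nontrivial V] : (0 : V) ∉ S.interiorCone := fun h =>
  S.neg_notMem_of_mem_interiorCone h (by simp)

/-! ### Upper and lower coordinates relative to an interior point -/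

/-- The least `c` with `v ≤ c x`, for `x` in the interior of the cone. -/
noncomputable def upper (x v : V) : ℝ := sInf {c : ℝ | c • x - v ∈ S.cone}

/-- The greatest `c` with `c x ≤ v`, for `x` in the interior of the cone. -/
noncomputable def lower (x v : V) : ℝ := -S.upper x (-v)

theorem lower_neg (x v : V) : S.lower x (-v) = -S.upper x v := by
  rw [lower, neg_neg]

theorem upper_neg (x v : V) : S.upper x (-v) = -S.lower x v := by
  rw [lower, neg_neg]

variable [Nontrivial V]

theorem upper_le_iff {x : V} (hx : x ∈ S.interiorCone) {v : V} {c : ℝ} :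
    S.upper x v ≤ c ↔ c • x - v ∈ S.cone := by
  have hxC := S.mem_cone_of_mem_interiorCone hx
  have hbdd : BddBelow {c : ℝ | c • x - v ∈ S.cone} := by
    obtain ⟨r, hr, h⟩ := S.exists_smul_sub_mem hx (-v)
    refine ⟨-r, fun c hc => ?_⟩
    by_contra! hlt
    have h₁ : (c + r) • x ∈ S.cone := by
      convert S.cone.add_mem (show c • x - v ∈ S.cone from hc) h using 1; module
    have h₂ := S.smul_mem_cone (inv_nonneg.2 (show 0 ≤ -(c + r) by linarith)) h₁
    refine S.neg_notMem_of_mem_interiorCone hx ?_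
    convert h₂ using 1
    rw [smul_smul, inv_neg, neg_mul, inv_mul_cancel₀ (by linarith), neg_smul, one_smul]
  constructor
  · intro hc
    refine S.mem_of_forall_add_smul_mem hxC fun ε hε => ?_
    have hne : {c : ℝ | c • x - v ∈ S.cone}.Nonempty := by
      obtain ⟨r, _, h⟩ := S.exists_smul_sub_mem hx v
      exact ⟨r, h⟩
    obtain ⟨d, hd, hdc⟩ := exists_lt_of_csInf_lt hne (show S.upper x v < c + ε by linarith)
    convert S.cone.add_mem (show d • x - v ∈ S.cone from hd)
      (S.smul_mem_cone (sub_nonneg.2 hdc.le) hxC) using 1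
    module
  · exact fun h => csInf_le hbdd h

theorem le_lower_iff {x : V} (hx : x ∈ S.interiorCone) {v : V} {c : ℝ} :
    c ≤ S.lower x v ↔ v - c • x ∈ S.cone := by
  rw [lower, le_neg, S.upper_le_iff hx]
  have e : (-c) • x - -v = v - c • x := by module
  rw [e]

theorem upper_smul_sub_mem_boundaryCone {x : V} (hx : x ∈ S.interiorCone) (v : V) :
    S.upper x v • x - v ∈ S.boundaryCone := by
  refine S.mem_boundaryCone_iff.2 ⟨(S.upper_le_iff hx).1 le_rfl, fun h => ?_⟩
  obtain ⟨ε, hε, h⟩ := (S.mem_interiorCone_iff_of_mem hx).1 h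
  have : S.upper x v ≤ S.upper x v - ε := by
    rw [S.upper_le_iff hx]
    convert h using 1; module
  linarith

theorem sub_lower_smul_mem_boundaryCone {x : V} (hx : x ∈ S.interiorCone) (v : V) :
    v - S.lower x v • x ∈ S.boundaryCone := by
  convert S.upper_smul_sub_mem_boundaryCone hx (-v) using 1
  rw [lower]; module

theorem lower_le_upper {x : V} (hx : x ∈ S.interiorCone) (v : V) :
    S.lower x v ≤ S.upper x v := by
  by_contra! h
  have h₁ := (S.le_lower_iff hx (v := v)).1 le_rfl
  have h₂ := (S.upper_le_iff hx (v := v)).1 le_rfl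
  have h₃ : (S.upper x v - S.lower x v) • x ∈ S.cone := by
    convert S.cone.add_mem h₁ h₂ using 1; module
  have h₄ := S.smul_mem_cone (inv_nonneg.2 (sub_nonneg.2 h.le)) h₃
  refine S.neg_notMem_of_mem_interiorCone hx ?_
  convert h₄ using 1
  rw [smul_smul, ← neg_sub (S.lower x v), mul_neg, inv_mul_cancel₀ (by linarith)]
  module

theorem eq_smul_of_lower_eq_upper {x : V} (hx : x ∈ S.interiorCone) {v : V}
    (h : S.lower x v = S.upper x v) : v = S.upper x v • x := by
  have h₁ := (S.le_lower_iff hx (v := v)).1 le_rfl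
  have h₂ := (S.upper_le_iff hx (v := v)).1 le_rfl
  rw [h] at h₁
  exact sub_eq_zero.1 (S.salient _ h₁ (by simpa using h₂))

theorem upper_add_smul {x : V} (hx : x ∈ S.interiorCone) (v : V) (c : ℝ) :
    S.upper x (v + c • x) = S.upper x v + c := by
  refine eq_of_forall_ge_iff fun d => ?_
  rw [S.upper_le_iff hx, ← le_sub_iff_add_le, S.upper_le_iff hx]
  have e : d • x - (v + c • x) = (d - c) • x - v := by module
  rw [e]

theorem upper_smul {x : V} (hx : x ∈ S.interiorCone) (v : V) {c : ℝ} (hc : 0 < c) :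
    S.upper x (c • v) = c * S.upper x v := by
  refine eq_of_forall_ge_iff fun d => ?_
  rw [S.upper_le_iff hx, ← le_div_iff₀' hc, S.upper_le_iff hx]
  have e : d • x - c • v = c • ((d / c) • x - v) := by
    match_scalars <;> field_simp
  rw [e]
  refine ⟨fun h => ?_, S.smul_mem_cone hc.le⟩
  simpa [smul_smul, inv_mul_cancel₀ hc.ne'] using S.smul_mem_cone (inv_nonneg.2 hc.le) h

theorem lower_add_smul {x : V} (hx : x ∈ S.interiorCone) (v : V) (c : ℝ) :
    S.lower x (v + c • x) = S.lower x v + c := by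
  have e : -(v + c • x) = -v + (-c) • x := by module
  rw [lower, e, S.upper_add_smul hx, lower]; ring

theorem lower_smul {x : V} (hx : x ∈ S.interiorCone) (v : V) {c : ℝ} (hc : 0 < c) :
    S.lower x (c • v) = c * S.lower x v := by
  rw [lower, ← smul_neg, S.upper_smul hx _ hc, lower]; ring

theorem upper_zero {x : V} (hx : x ∈ S.interiorCone) : S.upper x 0 = 0 := by
  have := S.upper_smul hx (0 : V) (c := 2) two_pos
  rw [smul_zero] at this
  linarith

theorem unitNorm_eq_max (v : V) :
    S.unitNorm v = max (S.upper S.unit v) (-S.lower S.unit v) := by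
  have hu := S.unit_mem_interiorCone
  have h := S.lower_le_upper hu v
  have h0 : 0 ≤ max (S.upper S.unit v) (-S.lower S.unit v) := by
    by_contra! h0
    rw [max_lt_iff] at h0
    linarith
  have key : ∀ r : ℝ, 0 ≤ r →
      (S.unitNorm v ≤ r ↔ max (S.upper S.unit v) (-S.lower S.unit v) ≤ r) := fun r hr => by
    rw [S.unitNorm_le_iff hr, max_le_iff, S.upper_le_iff hu, neg_le, S.le_lower_iff hu]
    have e : v - (-r) • S.unit = v + r • S.unit := by module
    rw [e]
  exact le_antisymm ((key _ h0).2 le_rfl) ((key _ (S.unitNorm_nonneg v)).1 le_rfl)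

end OrderUnitSpace

namespace OrderUnitSpace

variable {V : Type u} [AddCommGroup V] [Module ℝ V] {S : OrderUnitSpace V}

/-! ### Antihomogeneous order-antimorphisms on two-dimensional slices -/

/-- `G` restricts to an antihomogeneous order-antimorphism of the interior of the cone into itself.
A function on all of `V` is used to avoid subtypes; its values off the interior are irrelevant. -/
structure IsInversion (S : OrderUnitSpace V) (G : V → V) : Prop where
  mapsTo : ∀ x ∈ S.interiorCone, G x ∈ S.interiorCone
  map_smul : ∀ r : ℝ, 0 < r → ∀ x ∈ S.interiorCone, G (r • x) = r⁻¹ • G x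
  sub_mem_iff : ∀ x ∈ S.interiorCone, ∀ y ∈ S.interiorCone,
    y - x ∈ S.cone ↔ G x - G y ∈ S.cone

namespace IsInversion

variable {G : V → V}

theorem injOn (hG : S.IsInversion G) {x y : V} (hx : x ∈ S.interiorCone)
    (hy : y ∈ S.interiorCone) (h : G x = G y) :
    x = y := by
  have h₁ := (hG.sub_mem_iff x hx y hy).2 (by simp [h])
  have h₂ := (hG.sub_mem_iff y hy x hx).2 (by simp [h])
  exact (sub_eq_zero.1 (S.salient _ h₁ (by simpa using h₂))).symm

theorem sub_smul_mem_iff (hG : S.IsInversion G) {x y : V} (hx : x ∈ S.interiorCone)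
    (hy : y ∈ S.interiorCone) {c : ℝ} (hc : 0 < c) : c • y - x ∈ S.cone ↔ c • G x - G y ∈ S.cone := by
  rw [hG.sub_mem_iff x hx _ (S.smul_mem_interiorCone hc hy), hG.map_smul c hc y hy]
  have e : c • G x - G y = c • (G x - c⁻¹ • G y) := by
    rw [smul_sub, smul_inv_smul₀ hc.ne']
  rw [e]
  refine ⟨S.smul_mem_cone hc.le, fun h => ?_⟩
  simpa [smul_smul, inv_mul_cancel₀ hc.ne'] using S.smul_mem_cone (inv_nonneg.2 hc.le) h

/-- `y - x` is interior iff `x ≤ c y` for some `0 < c < 1`, a condition that `G` reverses. -/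
theorem sub_mem_interiorCone_iff (hG : S.IsInversion G) {x y : V} (hx : x ∈ S.interiorCone)
    (hy : y ∈ S.interiorCone) :
    y - x ∈ S.interiorCone ↔ G x - G y ∈ S.interiorCone := by
  have key : ∀ p ∈ S.interiorCone, ∀ q ∈ S.interiorCone,
      (q - p ∈ S.interiorCone ↔ ∃ c : ℝ, 0 < c ∧ c < 1 ∧ c • q - p ∈ S.cone) := by
    intro p hp q hq
    rw [S.mem_interiorCone_iff_of_mem hq]
    constructor
    · rintro ⟨ε, hε, h⟩
      refine ⟨max (1 - ε) (1 / 2), by positivity, max_lt (by linarith) (by norm_num), ?_⟩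
      have := S.cone.add_mem h (S.smul_mem_cone (sub_nonneg.2 (le_max_left (1 - ε) (1 / 2)))
        (S.mem_cone_of_mem_interiorCone hq))
      convert this using 1; module
    · rintro ⟨c, _, hc, h⟩
      refine ⟨1 - c, by linarith, ?_⟩
      convert h using 1; module
  rw [key x hx y hy, key _ (hG.mapsTo y hy) _ (hG.mapsTo x hx)]
  refine exists_congr fun c => and_congr_right fun hc => and_congr_right fun _ => ?_
  exact hG.sub_smul_mem_iff hx hy hc

theorem sub_mem_boundaryCone_iff (hG : S.IsInversion G) {x y : V} (hx : x ∈ S.interiorCone)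
    (hy : y ∈ S.interiorCone) :
    y - x ∈ S.boundaryCone ↔ G x - G y ∈ S.boundaryCone := by
  rw [S.mem_boundaryCone_iff, S.mem_boundaryCone_iff, hG.sub_mem_iff x hx y hy,
    hG.sub_mem_interiorCone_iff hx hy]

end IsInversion

theorem smul_mem_boundaryCone {r : ℝ} (hr : 0 < r) {x : V} (hx : x ∈ S.boundaryCone) :
    r • x ∈ S.boundaryCone := by
  rw [S.mem_boundaryCone_iff] at hx ⊢
  exact ⟨S.smul_mem_cone hr.le hx.1, fun h => hx.2 ((S.smul_mem_interiorCone_iff hr).1 h)⟩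

section Slice

variable {G : V → V} {r s : V}

theorem add_smul_mem_interiorCone (hr : r ∈ S.boundaryCone) (hs : s ∈ S.boundaryCone)
    (hrs : r + s ∈ S.interiorCone) {t : ℝ} (ht : 0 < t) : r + t • s ∈ S.interiorCone := by
  simpa using S.smul_add_smul_mem_interiorCone (S.mem_boundaryCone_iff.1 hr).1
    (S.mem_boundaryCone_iff.1 hs).1 hrs one_pos ht

theorem IsInversion.slice_sub_mem (hG : S.IsInversion G) (hr : r ∈ S.boundaryCone)
    (hs : s ∈ S.boundaryCone) (hrs : r + s ∈ S.interiorCone) {a b : ℝ} (ha : 0 < a)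
    (hab : a < b) : G (r + a • s) - G (r + b • s) ∈ S.boundaryCone := by
  rw [← hG.sub_mem_boundaryCone_iff (add_smul_mem_interiorCone hr hs hrs ha)
    (add_smul_mem_interiorCone hr hs hrs (ha.trans hab))]
  convert smul_mem_boundaryCone (sub_pos.2 hab) hs using 1
  module

theorem ne_zero_of_add_mem_interiorCone (hr : r ∈ S.boundaryCone)
    (hrs : r + s ∈ S.interiorCone) : s ≠ 0 := by
  rintro rfl
  exact (S.mem_boundaryCone_iff.1 hr).2 (by simpa using hrs)

theorem IsInversion.slice_ne (hG : S.IsInversion G) (hr : r ∈ S.boundaryCone)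
    (hs : s ∈ S.boundaryCone) (hrs : r + s ∈ S.interiorCone) {a b : ℝ} (ha : 0 < a) (hb : 0 < b)
    (hab : a ≠ b) : G (r + a • s) - G (r + b • s) ≠ 0 := by
  intro h
  have := hG.injOn (add_smul_mem_interiorCone hr hs hrs ha)
    (add_smul_mem_interiorCone hr hs hrs hb) (sub_eq_zero.1 h)
  have h0 : (a - b) • s = 0 := by
    rw [sub_smul, sub_eq_zero]; exact add_left_cancel this
  exact (smul_ne_zero (sub_ne_zero.2 hab) (ne_zero_of_add_mem_interiorCone hr hrs)) h0

/-- Along the ray `r + t s` parallel to a boundary ray, the images under `G` are collinear: for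
three ordered parameters the two successive differences and their sum are boundary vectors, so
strict convexity makes them dependent. -/
theorem IsInversion.slice_collinear (hG : S.IsInversion G) (hS : S.StrictlyConvexCone)
    (hr : r ∈ S.boundaryCone) (hs : s ∈ S.boundaryCone) (hrs : r + s ∈ S.interiorCone) {a b t : ℝ}
    (ha : 0 < a) (hb : 0 < b) (ht : 0 < t) (hab : a ≠ b) :
    ∃ c : ℝ, G (r + t • s) - G (r + a • s) = c • (G (r + b • s) - G (r + a • s)) := by
  -- for `a < b < c`, the middle image is a nontrivial combination of the outer two
  have key : ∀ {a b c : ℝ}, 0 < a → a < b → b < c → ∃ k : ℝ,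
      G (r + b • s) - G (r + a • s) = k • (G (r + c • s) - G (r + a • s)) ∧ k ≠ 0 ∧ k ≠ 1 := by
    intro a b c ha hab hbc
    have hb := ha.trans hab
    obtain ⟨k, l, hkl, hne⟩ := hS.exists_smul_add_smul_eq_zero
      (hG.slice_sub_mem hr hs hrs ha hab) (hG.slice_sub_mem hr hs hrs hb hbc)
      (by simpa using hG.slice_sub_mem hr hs hrs ha (hab.trans hbc))
    have h₁ := hG.slice_ne hr hs hrs ha hb hab.ne
    have h₂ := hG.slice_ne hr hs hrs hb (hb.trans hbc) hbc.ne
    have h₃ := hG.slice_ne hr hs hrs ha (hb.trans hbc) (hab.trans hbc).ne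
    generalize G (r + a • s) = A at *
    generalize G (r + b • s) = B at *
    generalize G (r + c • s) = D at *
    have e₁ : (k - l) • (B - A) = (-l) • (D - A) := by
      rw [← sub_eq_zero, ← neg_eq_zero, ← hkl]; module
    have hkl' : k - l ≠ 0 := by
      intro h0
      rw [h0, zero_smul] at e₁
      rcases smul_eq_zero.1 e₁.symm with h | h
      · exact hne ⟨by linarith, by linarith⟩
      · exact h₃ (by rw [← neg_sub, h, neg_zero])
    have e₂ : B - A = ((k - l)⁻¹ * (-l)) • (D - A) := by
      rw [mul_smul, ← e₁, inv_smul_smul₀ hkl']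
    refine ⟨_, e₂, fun h0 => ?_, fun h1 => ?_⟩
    · rw [h0, zero_smul] at e₂
      exact h₁ (by rw [← neg_sub, e₂, neg_zero])
    · rw [h1, one_smul] at e₂
      exact h₂ (by rw [sub_left_inj.1 e₂, sub_self])
  have key' : ∀ {a b t : ℝ}, 0 < a → a < b → 0 < t →
      ∃ c : ℝ, G (r + t • s) - G (r + a • s) = c • (G (r + b • s) - G (r + a • s)) := by
    intro a b t ha hab ht
    rcases lt_trichotomy t a with h | rfl | h
    · obtain ⟨k, hk, h0, h1⟩ := key ht h hab
      refine ⟨k * (k - 1)⁻¹, ?_⟩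
      have h1' := sub_ne_zero.2 h1
      generalize G (r + a • s) = A at *
      generalize G (r + b • s) = B at *
      generalize G (r + t • s) = D at *
      have e : (k - 1) • (D - A) = k • (B - A) := by
        have : (k - 1) • (D - A) - k • (B - A) = (A - D) - k • (B - D) := by module
        rw [← sub_eq_zero, this, hk, sub_self]
      rw [mul_comm, mul_smul, ← e, inv_smul_smul₀ h1']
    · exact ⟨0, by simp⟩
    rcases lt_trichotomy t b with h' | rfl | h'
    · obtain ⟨k, hk, -, -⟩ := key ha h h'
      exact ⟨k, hk⟩
    · exact ⟨1, by simp⟩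
    · obtain ⟨k, hk, h0, -⟩ := key ha hab h'
      exact ⟨k⁻¹, by rw [hk, inv_smul_smul₀ h0]⟩
  rcases lt_or_gt_of_ne hab with h | h
  · exact key' ha h ht
  · obtain ⟨c, hc⟩ := key' hb h ht
    refine ⟨1 - c, ?_⟩
    have e : G (r + t • s) - G (r + a • s)
      = (G (r + t • s) - G (r + b • s)) - (G (r + a • s) - G (r + b • s)) := by module
    rw [e, hc]; module

/-- On the two-dimensional slice spanned by the boundary rays of `r` and `s`, the map `G` inverts
the coordinates with respect to suitable boundary vectors `r'` and `s'`. -/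
theorem IsInversion.exists_slice (hG : S.IsInversion G) (hS : S.StrictlyConvexCone)
    (hr : r ∈ S.boundaryCone) (hs : s ∈ S.boundaryCone) (hrs : r + s ∈ S.interiorCone) :
    ∃ r' ∈ S.cone, ∃ s' ∈ S.cone, (∀ a b : ℝ, a • r' + b • s' = 0 → a = 0 ∧ b = 0) ∧
      ∀ a b : ℝ, 0 < a → 0 < b → G (a • r + b • s) = a⁻¹ • r' + b⁻¹ • s' := by
  have hsr : s + r ∈ S.interiorCone := by rwa [add_comm]
  -- exchanging the roles of `r` and `s` amounts to rescaling the parameter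
  have swap : ∀ t : ℝ, 0 < t → G (s + t⁻¹ • r) = t • G (r + t • s) := by
    intro t ht
    have e : s + t⁻¹ • r = t⁻¹ • (r + t • s) := by
      rw [smul_add, inv_smul_smul₀ ht.ne', add_comm]
    rw [e, hG.map_smul _ (inv_pos.2 ht) _ (add_smul_mem_interiorCone hr hs hrs ht), inv_inv]
  have hs₁ := hG.slice_sub_mem hr hs hrs one_pos one_lt_two
  have hs₁0 := hG.slice_ne hr hs hrs one_pos two_pos (by norm_num)
  have hr₁ := hG.slice_sub_mem hs hr hsr (a := 2⁻¹) (b := 1⁻¹) (by norm_num) (by norm_num)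
  have hr₁0 := hG.slice_ne hs hr hsr (a := 2⁻¹) (b := 1⁻¹) (by norm_num) (by norm_num)
    (by norm_num)
  have hy₁ := hG.mapsTo _ (add_smul_mem_interiorCone hr hs hrs one_pos)
  rw [swap 2 two_pos, swap 1 one_pos, one_smul] at hr₁ hr₁0
  have col : ∀ t : ℝ, 0 < t → ∃ c d : ℝ,
      G (r + t • s) = G (r + (1 : ℝ) • s) + c • (G (r + (1 : ℝ) • s) - G (r + (2 : ℝ) • s)) ∧
      t • G (r + t • s) = G (r + (1 : ℝ) • s)
        + d • ((2 : ℝ) • G (r + (2 : ℝ) • s) - G (r + (1 : ℝ) • s)) := by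
    intro t ht
    obtain ⟨c, hc⟩ := hG.slice_collinear hS hr hs hrs one_pos two_pos ht (by norm_num)
    obtain ⟨d, hd⟩ := hG.slice_collinear hS hs hr hsr (a := 1⁻¹) (b := 2⁻¹) (t := t⁻¹)
      (by norm_num) (by norm_num) (by positivity) (by norm_num)
    rw [swap 2 two_pos, swap 1 one_pos, swap t ht, one_smul] at hd
    refine ⟨-c, d, ?_, ?_⟩
    · rw [sub_eq_iff_eq_add.1 hc]; module
    · rw [sub_eq_iff_eq_add.1 hd]; module
  generalize hA : G (r + (1 : ℝ) • s) = A at *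
  generalize hB : G (r + (2 : ℝ) • s) = B at *
  have hAeq : ((2 : ℝ) • B - A) + (2 : ℝ) • (A - B) = A := by module
  have hs' := smul_mem_boundaryCone two_pos hs₁
  have hs'0 : (2 : ℝ) • (A - B) ≠ 0 := smul_ne_zero two_ne_zero hs₁0
  have col' : ∀ t : ℝ, 0 < t → ∃ c d : ℝ, G (r + t • s) = A + c • ((2 : ℝ) • (A - B)) ∧
      t • G (r + t • s) = A + d • ((2 : ℝ) • B - A) := by
    intro t ht
    obtain ⟨c, d, hc, hd⟩ := col t ht
    exact ⟨c / 2, d, by rw [hc, smul_smul]; congr 2; ring, hd⟩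
  generalize hρ : (2 : ℝ) • B - A = ρ at *
  generalize hσ : (2 : ℝ) • (A - B) = σ at *
  have hρC := (S.mem_boundaryCone_iff.1 hr₁).1
  have hσC := (S.mem_boundaryCone_iff.1 hs').1
  have hli : ∀ a b : ℝ, a • ρ + b • σ = 0 → a = 0 ∧ b = 0 := by
    intro a b hab
    by_cases hb : b = 0
    · subst hb
      rw [zero_smul, add_zero] at hab
      exact ⟨(smul_eq_zero.1 hab).resolve_right hr₁0, rfl⟩
    exfalso
    have e : σ = (-(b⁻¹ * a)) • ρ := by
      have : σ = b⁻¹ • (a • ρ + b • σ) + (-(b⁻¹ * a)) • ρ := by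
        rw [smul_add, inv_smul_smul₀ hb]; module
      rwa [hab, smul_zero, zero_add] at this
    generalize -(b⁻¹ * a) = k at e
    have hk : 0 ≤ k := by
      by_contra! hk
      refine hr₁0 (S.salient _ hρC ?_)
      have := S.smul_mem_cone (inv_nonneg.2 (neg_nonneg.2 hk.le)) hσC
      rwa [e, smul_smul, inv_neg, neg_mul, inv_mul_cancel₀ hk.ne, neg_one_smul] at this
    have hA' : A = (1 + k) • ρ := by rw [← hAeq, e]; module
    rw [hA', S.smul_mem_interiorCone_iff (by linarith)] at hy₁
    exact (S.mem_boundaryCone_iff.1 hr₁).2 hy₁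
  have main : ∀ t : ℝ, 0 < t → G (r + t • s) = ρ + t⁻¹ • σ := by
    intro t ht
    obtain ⟨c, d, hc, hd⟩ := col' t ht
    have h0 : (t - 1 - d) • ρ + (t + t * c - 1) • σ = 0 := by
      rw [hc, ← hAeq] at hd
      rw [← sub_eq_zero.2 hd]; module
    have h1 := (hli _ _ h0).2
    have hc' : 1 + c = t⁻¹ := by field_simp; linarith
    rw [hc, ← hAeq, ← hc']; module
  refine ⟨ρ, hρC, σ, hσC, hli, fun a b ha hb => ?_⟩
  have e : a • r + b • s = a • (r + (b / a) • s) := by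
    rw [smul_add, smul_smul, mul_div_cancel₀ _ ha.ne']
  rw [e, hG.map_smul a ha _ (add_smul_mem_interiorCone hr hs hrs (by positivity)),
    main _ (by positivity), smul_add, smul_smul]
  congr 2
  field_simp

variable [Nontrivial V]

/-- The slice formula in coordinates centred at an interior point `x`. -/
theorem IsInversion.exists_decomposition (hG : S.IsInversion G) (hS : S.StrictlyConvexCone)
    {x : V} (hx : x ∈ S.interiorCone) (v : V) :
    ∃ r' ∈ S.cone, ∃ s' ∈ S.cone, r' + s' = G x ∧
      (S.upper x v • r' + S.lower x v • s' = 0 → v = 0) ∧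
      ∀ t : ℝ, 0 < 1 + t * S.upper x v → 0 < 1 + t * S.lower x v →
        G (x + t • v) = (1 + t * S.upper x v)⁻¹ • r' + (1 + t * S.lower x v)⁻¹ • s' := by
  have hr := S.sub_lower_smul_mem_boundaryCone hx v
  have hs := S.upper_smul_sub_mem_boundaryCone hx v
  have hle := S.lower_le_upper hx v
  have heq := S.eq_smul_of_lower_eq_upper hx (v := v)
  generalize S.upper x v = M at *
  generalize S.lower x v = m at *
  rcases hle.eq_or_lt with h | h
  · subst h
    have hv := heq rfl
    refine ⟨G x, S.mem_cone_of_mem_interiorCone (hG.mapsTo x hx), 0, S.cone.zero_mem,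
      add_zero _, fun h0 => ?_, fun t ht _ => ?_⟩
    · rw [smul_zero, add_zero, smul_eq_zero] at h0
      rcases h0 with h0 | h0
      · rw [hv, h0, zero_smul]
      · exact absurd (h0 ▸ hG.mapsTo x hx) S.zero_notMem_interiorCone
    · have e : x + t • v = (1 + t * m) • x := by
        rw [hv, smul_smul]; module
      rw [e, hG.map_smul _ ht x hx, smul_zero, add_zero]
  · have hd : 0 < M - m := sub_pos.2 h
    have hr' := smul_mem_boundaryCone (inv_pos.2 hd) hr
    have hs' := smul_mem_boundaryCone (inv_pos.2 hd) hs
    have hsum : (M - m)⁻¹ • (v - m • x) + (M - m)⁻¹ • (M • x - v) = x := by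
      match_scalars <;> field_simp <;> ring
    have hline : ∀ t : ℝ, (1 + t * M) • (M - m)⁻¹ • (v - m • x)
        + (1 + t * m) • (M - m)⁻¹ • (M • x - v) = x + t • v := by
      intro t
      match_scalars <;> field_simp <;> ring
    obtain ⟨r', hr'C, s', hs'C, hli, hform⟩ := hG.exists_slice hS hr' hs' (by rwa [hsum])
    refine ⟨r', hr'C, s', hs'C, ?_, fun h0 => ?_, fun t h₁ h₂ => ?_⟩
    · have := hform 1 1 one_pos one_pos
      rw [one_smul, one_smul, hsum] at this
      rw [this]; simp
    · obtain ⟨h₁, h₂⟩ := hli _ _ h0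
      linarith
    · rw [← hform _ _ h₁ h₂, hline]

end Slice

end OrderUnitSpace

/-! ### Differentiating the antimorphism at the order unit -/

open Filter Topology in
/-- If functions `F s`, continuous at `0`, approximate `D` near `0` with an error `O(s)` that is
uniform in the argument, then the diagonal values `F t t` tend to `D 0`. -/
theorem tendsto_diagonal_of_uniform_approx {E : Type*} [NormedAddCommGroup E] {D : ℝ → E}
    {F : ℝ → ℝ → E} {K δ : ℝ} (hδ : 0 < δ)
    (hF : ∀ s, 0 < s → s < δ → ContinuousAt (F s) 0)
    (h : ∀ s t, 0 < s → s < δ → |t| < δ → ‖D t - F s t‖ ≤ K * s) :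
    Tendsto (fun t => F t t) (𝓝[>] 0) (𝓝 (D 0)) := by
  have hK : 0 ≤ K := by
    have := (norm_nonneg _).trans (h (δ / 2) 0 (by positivity) (by linarith) (by simpa using hδ))
    exact nonneg_of_mul_nonneg_left this (by positivity)
  rw [Metric.tendsto_nhds]
  intro ε hε
  obtain ⟨s, hs, hsδ, hsε⟩ : ∃ s, 0 < s ∧ s < δ ∧ K * s ≤ ε / 5 := by
    refine ⟨min (δ / 2) (ε / 5 / (K + 1)), by positivity,
      (min_le_left _ _).trans_lt (by linarith), ?_⟩
    calc K * min (δ / 2) (ε / 5 / (K + 1)) ≤ (K + 1) * (ε / 5 / (K + 1)) := by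
          gcongr
          · linarith
          · exact min_le_right _ _
      _ = ε / 5 := by field_simp
  have h₁ : ∀ᶠ t in 𝓝[>] (0 : ℝ), dist (F s t) (F s 0) < ε / 5 :=
    ((hF s hs hsδ).eventually (Metric.ball_mem_nhds _ (by positivity))).filter_mono
      nhdsWithin_le_nhds
  have h₂ : ∀ᶠ t in 𝓝[>] (0 : ℝ), t ∈ Set.Ioo 0 s := Ioo_mem_nhdsGT hs
  filter_upwards [h₁, h₂] with t ht₁ ht₂
  have a₁ := h s t hs hsδ (by rw [abs_of_pos ht₂.1]; linarith [ht₂.2])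
  have a₂ := h t t ht₂.1 (by linarith [ht₂.2]) (by rw [abs_of_pos ht₂.1]; linarith [ht₂.2])
  have a₃ := h s 0 hs hsδ (by simpa using hδ)
  have a₄ : K * t ≤ K * s := by gcongr; exact ht₂.2.le
  rw [dist_eq_norm] at ht₁ ⊢
  have e : F t t - D 0 = -(D t - F t t) + (D t - F s t) + (F s t - F s 0) + -(D 0 - F s 0) := by
    abel
  rw [e]
  refine (norm_add₄_le).trans_lt ?_
  rw [norm_neg, norm_neg]
  linarith

open Filter Topology in
theorem tendsto_of_norm_sub_le {E : Type*} [NormedAddCommGroup E] {F : ℝ → E} {y : E}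
    {K δ : ℝ} (hδ : 0 < δ)
    (h : ∀ t, 0 < t → t < δ → ‖F t - y‖ ≤ K * t) : Tendsto F (𝓝[>] 0) (𝓝 y) := by
  rw [tendsto_iff_norm_sub_tendsto_zero]
  have hK : Tendsto (fun t : ℝ => K * t) (𝓝[>] 0) (𝓝 0) := by
    have : Tendsto (fun t : ℝ => K * t) (𝓝 0) (𝓝 (K * 0)) := (continuous_const_mul K).tendsto 0
    rw [mul_zero] at this
    exact this.mono_left nhdsWithin_le_nhds
  refine squeeze_zero' (Eventually.of_forall fun _ => norm_nonneg _) ?_ hK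
  filter_upwards [Ioo_mem_nhdsGT hδ] with t ht
  exact h t ht.1 ht.2

theorem abs_inv_one_add_sub_first_le {z : ℝ} (hz : |z| ≤ 1 / 2) :
    |(1 + z)⁻¹ - 1 + z| ≤ 2 * |z| ^ 2 := by
  have h := abs_le.1 hz
  have h0 : 0 < 1 + z := by linarith
  have e : (1 + z)⁻¹ - 1 + z = (1 + z)⁻¹ * z ^ 2 := by field_simp; ring
  rw [e, abs_mul, abs_pow, abs_of_pos (inv_pos.2 h0)]
  gcongr
  exact inv_le_of_inv_le₀ two_pos (by linarith)

theorem abs_inv_one_add_sub_second_le {z : ℝ} (hz : |z| ≤ 1 / 2) :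
    |(1 + z)⁻¹ - 1 + z - z ^ 2| ≤ 2 * |z| ^ 3 := by
  have h := abs_le.1 hz
  have h0 : 0 < 1 + z := by linarith
  have e : (1 + z)⁻¹ - 1 + z - z ^ 2 = -((1 + z)⁻¹ * z ^ 3) := by field_simp; ring
  rw [e, abs_neg, abs_mul, abs_pow, abs_of_pos (inv_pos.2 h0)]
  gcongr
  exact inv_le_of_inv_le₀ two_pos (by linarith)

namespace OrderUnitSpace

variable {E : Type u} [NormedAddCommGroup E] [NormedSpace ℝ E] {S : OrderUnitSpace E}
  {G : E → E}

/-- The second order expansion `G (x + t v) = G x - t T + t² Q + O(t³)` of `G` at `x` in the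
direction `v`, with explicit remainders. The coefficient `Q` is expressed through `T` by means of
the upper and lower coordinates of `v` relative to `x`. -/
structure IsExpansion (S : OrderUnitSpace E) (G : E → E) (x v T Q : E) : Prop where
  eq_zero : T = 0 → v = 0
  const : S.lower x v = S.upper x v → T = S.upper x v • G x
  quad : Q = (S.upper x v + S.lower x v) • T - (S.upper x v * S.lower x v) • G x
  hasDerivAt : HasDerivAt (fun t : ℝ => G (x + t • v)) (-T) 0
  first : ∀ L t : ℝ, |S.upper x v| ≤ L → |S.lower x v| ≤ L → |t| * L ≤ 1 / 2 →
    ‖G (x + t • v) - G x + t • T‖ ≤ 4 * ‖G x‖ * L ^ 2 * |t| ^ 2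
  second : ∀ L t : ℝ, |S.upper x v| ≤ L → |S.lower x v| ≤ L → |t| * L ≤ 1 / 2 →
    ‖G (x + t • v) - G x + t • T - t ^ 2 • Q‖ ≤ 4 * ‖G x‖ * L ^ 3 * |t| ^ 3

theorem norm_smul_add_smul_le (hn : ∀ v : E, S.unitNorm v = ‖v‖) {r s y : E} (hr : r ∈ S.cone)
    (hs : s ∈ S.cone) (hrs : r + s = y) {a b c : ℝ} (ha : |a| ≤ c) (hb : |b| ≤ c) :
    ‖a • r + b • s‖ ≤ 2 * c * ‖y‖ := by
  have h₁ : ‖r‖ ≤ ‖y‖ := by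
    rw [← hn, ← hn]; exact S.unitNorm_le_unitNorm hr (by rw [← hrs]; simpa using hs)
  have h₂ : ‖s‖ ≤ ‖y‖ := by
    rw [← hn, ← hn]; exact S.unitNorm_le_unitNorm hs (by rw [← hrs]; simpa using hr)
  calc ‖a • r + b • s‖ ≤ ‖a • r‖ + ‖b • s‖ := norm_add_le _ _
    _ = |a| * ‖r‖ + |b| * ‖s‖ := by rw [norm_smul, norm_smul, Real.norm_eq_abs, Real.norm_eq_abs]
    _ ≤ c * ‖y‖ + c * ‖y‖ := by
        have := (abs_nonneg a).trans ha
        gcongr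
    _ = _ := by ring

theorem hasDerivAt_inv_one_add_mul (M : ℝ) : HasDerivAt (fun t : ℝ => (1 + t * M)⁻¹) (-M) 0 := by
  have h : HasDerivAt (fun t : ℝ => 1 + t * M) M 0 := by
    simpa using ((hasDerivAt_id (0 : ℝ)).mul_const M).const_add 1
  have h' := h.inv (by simp)
  simp only [zero_mul, add_zero, one_pow, div_one] at h'
  exact h'

theorem eventually_one_add_mul_pos (M : ℝ) : ∀ᶠ t : ℝ in nhds 0, 0 < 1 + t * M := by
  have h : ContinuousAt (fun t : ℝ => 1 + t * M) 0 := by fun_prop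
  exact h.eventually (lt_mem_nhds (by simp))

theorem abs_mul_le_half {t L M : ℝ} (hM : |M| ≤ L) (ht : |t| * L ≤ 1 / 2) : |t * M| ≤ 1 / 2 := by
  rw [abs_mul]
  exact (by gcongr : |t| * |M| ≤ |t| * L).trans ht

theorem IsInversion.exists_isExpansion [Nontrivial E] (hG : S.IsInversion G)
    (hS : S.StrictlyConvexCone) (hn : ∀ v : E, S.unitNorm v = ‖v‖) {x : E}
    (hx : x ∈ S.interiorCone) (v : E) : ∃ T Q : E, S.IsExpansion G x v T Q := by
  obtain ⟨r, hr, s, hs, hrs, hinj, hform⟩ := hG.exists_decomposition hS hx v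
  refine ⟨S.upper x v • r + S.lower x v • s, S.upper x v ^ 2 • r + S.lower x v ^ 2 • s,
    hinj, fun h => ?_, ?_, ?_, fun L t hM hm ht => ?_, fun L t hM hm ht => ?_⟩
  · rw [h, ← hrs]; module
  · rw [← hrs]; module
  · have h := ((hasDerivAt_inv_one_add_mul (S.upper x v)).smul_const r).add
      ((hasDerivAt_inv_one_add_mul (S.lower x v)).smul_const s)
    have e : -(S.upper x v • r + S.lower x v • s)
      = (-S.upper x v) • r + (-S.lower x v) • s := by module
    rw [e]
    refine h.congr_of_eventuallyEq ?_
    filter_upwards [eventually_one_add_mul_pos (S.upper x v),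
      eventually_one_add_mul_pos (S.lower x v)] with t h₁ h₂
    exact hform t h₁ h₂
  all_goals
    have h₁ := abs_mul_le_half hM ht
    have h₂ := abs_mul_le_half hm ht
    rw [hform t (by linarith [(abs_le.1 h₁).1]) (by linarith [(abs_le.1 h₂).1])]
    have hL : 0 ≤ L := (abs_nonneg _).trans hM
    generalize S.upper x v = M at *
    generalize S.lower x v = m at *
  · have b₁ : |(1 + t * M)⁻¹ - 1 + t * M| ≤ 2 * (|t| * L) ^ 2 :=
      (abs_inv_one_add_sub_first_le h₁).trans (by rw [abs_mul]; gcongr)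
    have b₂ : |(1 + t * m)⁻¹ - 1 + t * m| ≤ 2 * (|t| * L) ^ 2 :=
      (abs_inv_one_add_sub_first_le h₂).trans (by rw [abs_mul]; gcongr)
    convert norm_smul_add_smul_le hn hr hs hrs b₁ b₂ using 1
    · congr 1; rw [← hrs]; module
    · ring
  · have b₁ : |(1 + t * M)⁻¹ - 1 + t * M - (t * M) ^ 2| ≤ 2 * (|t| * L) ^ 3 :=
      (abs_inv_one_add_sub_second_le h₁).trans (by rw [abs_mul]; gcongr)
    have b₂ : |(1 + t * m)⁻¹ - 1 + t * m - (t * m) ^ 2| ≤ 2 * (|t| * L) ^ 3 :=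
      (abs_inv_one_add_sub_second_le h₂).trans (by rw [abs_mul]; gcongr)
    convert norm_smul_add_smul_le hn hr hs hrs b₁ b₂ using 1
    · congr 1; rw [← hrs]; module
    · ring

section Near

theorem mem_interiorCone_of_sub_half_mem {x : E} (hx : x - (1 / 2 : ℝ) • S.unit ∈ S.cone) :
    x ∈ S.interiorCone :=
  S.mem_interiorCone_iff.2 ⟨_, by norm_num, hx⟩

theorem half_unit_mem : S.unit - (1 / 2 : ℝ) • S.unit ∈ S.cone := by
  convert S.smul_mem_cone (r := 1 / 2) (by norm_num) S.unit_mem using 1; module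

theorem abs_upper_le_and_abs_lower_le [Nontrivial E] (hn : ∀ v : E, S.unitNorm v = ‖v‖) {x : E}
    (hx : x - (1 / 2 : ℝ) • S.unit ∈ S.cone) (v : E) :
    |S.upper x v| ≤ 2 * ‖v‖ ∧ |S.lower x v| ≤ 2 * ‖v‖ := by
  have hxI : x ∈ S.interiorCone := mem_interiorCone_of_sub_half_mem hx
  have h := (S.unitNorm_le_iff (v := v) (norm_nonneg v)).1 (hn v).le
  have hx' := S.smul_mem_cone (r := 2 * ‖v‖) (by positivity) hx
  have h₁ : S.upper x v ≤ 2 * ‖v‖ := by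
    rw [S.upper_le_iff hxI]
    convert S.cone.add_mem hx' h.1 using 1; module
  have h₂ : -(2 * ‖v‖) ≤ S.lower x v := by
    rw [S.le_lower_iff hxI]
    convert S.cone.add_mem hx' h.2 using 1; module
  have h₃ := S.lower_le_upper hxI v
  exact ⟨abs_le.2 ⟨by linarith, h₁⟩, abs_le.2 ⟨h₂, by linarith⟩⟩

theorem IsInversion.norm_le_two_mul (hG : S.IsInversion G) (hn : ∀ v : E, S.unitNorm v = ‖v‖)
    {x : E} (hx : x - (1 / 2 : ℝ) • S.unit ∈ S.cone) : ‖G x‖ ≤ 2 * ‖G S.unit‖ := by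
  have hxI : x ∈ S.interiorCone := mem_interiorCone_of_sub_half_mem hx
  have hu := S.unit_mem_interiorCone
  have h := (hG.sub_mem_iff _ (S.smul_mem_interiorCone (r := 1 / 2) (by norm_num) hu) x hxI).1 hx
  rw [hG.map_smul _ (by norm_num) _ hu] at h
  have := S.unitNorm_le_unitNorm (S.mem_cone_of_mem_interiorCone (hG.mapsTo x hxI)) h
  rw [hn, hn, norm_smul] at this
  simpa using this

theorem unit_add_smul_sub_mem (hn : ∀ v : E, S.unitNorm v = ‖v‖) {v : E} {t : ℝ}
    (ht : |t| * ‖v‖ ≤ 1 / 2) : S.unit + t • v - (1 / 2 : ℝ) • S.unit ∈ S.cone := by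
  have h : S.unitNorm (t • v) ≤ 1 / 2 := by rw [hn, norm_smul]; exact ht
  convert ((S.unitNorm_le_iff (by norm_num)).1 h).2 using 1; module

theorem mul_le_half_of_lt {L t : ℝ} (hL : 0 ≤ L) (ht : |t| < 1 / (2 * L + 1)) :
    |t| * L ≤ 1 / 2 := by
  rw [lt_div_iff₀ (by positivity)] at ht
  nlinarith [abs_nonneg t]

theorem unit_add_smul_sub_mem_of_lt (hn : ∀ v : E, S.unitNorm v = ‖v‖) {v w y : E}
    (hy : ‖y‖ ≤ ‖v‖ + ‖w‖) {t : ℝ} (ht : |t| < 1 / (2 * (2 * (‖v‖ + ‖w‖)) + 1)) :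
    S.unit + t • y - (1 / 2 : ℝ) • S.unit ∈ S.cone := by
  refine unit_add_smul_sub_mem hn ?_
  have := mul_le_half_of_lt (by positivity) ht
  have h' : |t| * ‖y‖ ≤ |t| * (‖v‖ + ‖w‖) := by gcongr
  nlinarith [abs_nonneg t, norm_nonneg v, norm_nonneg w]

end Near

section Derivative

variable {T Q : E → E → E}

/-- The directional derivatives of `G` at the order unit are additive in the direction. The
difference quotients of `G` at `u + t v` in the direction `w` converge uniformly in `t`, so the
derivative in the direction `w` is continuous along `t`, and the quotient with both increments
equal converges to it. -/
theorem IsInversion.expansion_add [Nontrivial E] (hG : S.IsInversion G)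
    (hn : ∀ v : E, S.unitNorm v = ‖v‖)
    (hT : ∀ x ∈ S.interiorCone, ∀ v, S.IsExpansion G x v (T x v) (Q x v)) (v w : E) :
    T S.unit (v + w) = T S.unit v + T S.unit w := by
  set L := 2 * (‖v‖ + ‖w‖) with hLdef
  have hL : 0 ≤ L := by positivity
  have hu := S.unit_mem_interiorCone
  have hδ : 0 < 1 / (2 * L + 1) := by positivity
  have first : ∀ x : E, x - (1 / 2 : ℝ) • S.unit ∈ S.cone → ∀ y : E, ‖y‖ ≤ ‖v‖ + ‖w‖ →
      ∀ t : ℝ, |t| < 1 / (2 * L + 1) →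
      ‖G (x + t • y) - G x + t • T x y‖ ≤ 8 * ‖G S.unit‖ * L ^ 2 * |t| ^ 2 := by
    intro x hx y hy t ht
    obtain ⟨h₁, h₂⟩ := abs_upper_le_and_abs_lower_le hn hx y
    refine ((hT x (mem_interiorCone_of_sub_half_mem hx) y).first L t (by linarith) (by linarith)
      (mul_le_half_of_lt hL ht)).trans ?_
    have := hG.norm_le_two_mul hn hx
    calc 4 * ‖G x‖ * L ^ 2 * |t| ^ 2 ≤ 4 * (2 * ‖G S.unit‖) * L ^ 2 * |t| ^ 2 := by gcongr
      _ = _ := by ring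
  have hlim := tendsto_diagonal_of_uniform_approx (D := fun t => T (S.unit + t • v) w)
    (F := fun s t => s⁻¹ • (G (S.unit + t • v) - G (S.unit + t • v + s • w)))
    (K := 8 * ‖G S.unit‖ * L ^ 2) hδ ?_ ?_
  · rw [zero_smul, add_zero] at hlim
    have hlim' := tendsto_of_norm_sub_le
      (F := fun t => t⁻¹ • (G (S.unit + t • v) - G (S.unit + t • v + t • w)))
      (y := T S.unit (v + w) - T S.unit v) (K := 16 * ‖G S.unit‖ * L ^ 2) hδ ?_
    · have := tendsto_nhds_unique hlim hlim'
      rw [this]; abel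
    intro t ht htδ
    have htδ' : |t| < 1 / (2 * L + 1) := by rwa [abs_of_pos ht]
    have a₁ := first _ half_unit_mem v (by linarith [norm_nonneg w]) t htδ'
    have a₂ := first _ half_unit_mem (v + w) (norm_add_le v w) t htδ'
    have e : t⁻¹ • (G (S.unit + t • v) - G (S.unit + t • v + t • w))
        - (T S.unit (v + w) - T S.unit v)
        = t⁻¹ • ((G (S.unit + t • v) - G S.unit + t • T S.unit v)
          - (G (S.unit + t • (v + w)) - G S.unit + t • T S.unit (v + w))) := by
      rw [add_assoc, ← smul_add]
      match_scalars <;> field_simp <;> ring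
    rw [e, norm_smul, norm_inv, Real.norm_eq_abs, abs_of_pos ht, inv_mul_le_iff₀ ht]
    refine (norm_sub_le _ _).trans ?_
    rw [abs_of_pos ht] at a₁ a₂
    linarith
  · intro s hs hsδ
    have hsδ' : |s| < 1 / (2 * L + 1) := by rwa [abs_of_pos hs]
    have c₁ := (hT _ hu v).hasDerivAt.continuousAt
    have hw : ‖w‖ ≤ ‖v‖ + ‖w‖ := by linarith [norm_nonneg v]
    have hx := mem_interiorCone_of_sub_half_mem (unit_add_smul_sub_mem_of_lt hn hw hsδ')
    have c₂ := (hT _ hx v).hasDerivAt.continuousAt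
    refine ContinuousAt.const_smul (c₁.sub ?_) _
    convert c₂ using 3
    abel
  · intro s t hs hsδ ht
    have hsδ' : |s| < 1 / (2 * L + 1) := by rwa [abs_of_pos hs]
    have a := first _ (unit_add_smul_sub_mem_of_lt (y := v) hn (by linarith [norm_nonneg w]) ht) w
      (by linarith [norm_nonneg v]) s hsδ'
    have e : T (S.unit + t • v) w - s⁻¹ • (G (S.unit + t • v) - G (S.unit + t • v + s • w))
        = s⁻¹ • (G (S.unit + t • v + s • w) - G (S.unit + t • v)
          + s • T (S.unit + t • v) w) := by
      match_scalars <;> field_simp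
    rw [e, norm_smul, norm_inv, Real.norm_eq_abs, abs_of_pos hs, inv_mul_le_iff₀ hs]
    rw [abs_of_pos hs] at a
    linarith

/-- The second derivatives of `G` at the order unit satisfy the parallelogram law, by the same
argument as for first derivatives, applied to symmetric second difference quotients. -/
theorem IsInversion.expansion_parallelogram [Nontrivial E] (hG : S.IsInversion G)
    (hn : ∀ v : E, S.unitNorm v = ‖v‖)
    (hT : ∀ x ∈ S.interiorCone, ∀ v, S.IsExpansion G x v (T x v) (Q x v)) (v w : E) :
    Q S.unit (v + w) + Q S.unit (v - w) = (2 : ℝ) • Q S.unit v + (2 : ℝ) • Q S.unit w := by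
  set L := 2 * (‖v‖ + ‖w‖) with hLdef
  have hL : 0 ≤ L := by positivity
  have hu := S.unit_mem_interiorCone
  have hδ : 0 < 1 / (2 * L + 1) := by positivity
  have second : ∀ x : E, x - (1 / 2 : ℝ) • S.unit ∈ S.cone → ∀ y : E, ‖y‖ ≤ ‖v‖ + ‖w‖ →
      ∀ t : ℝ, |t| < 1 / (2 * L + 1) →
      ‖G (x + t • y) - G x + t • T x y - t ^ 2 • Q x y‖ ≤
        8 * ‖G S.unit‖ * L ^ 3 * |t| ^ 3 := by
    intro x hx y hy t ht
    obtain ⟨h₁, h₂⟩ := abs_upper_le_and_abs_lower_le hn hx y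
    refine ((hT x (mem_interiorCone_of_sub_half_mem hx) y).second L t (by linarith) (by linarith)
      (mul_le_half_of_lt hL ht)).trans ?_
    have := hG.norm_le_two_mul hn hx
    calc 4 * ‖G x‖ * L ^ 3 * |t| ^ 3 ≤ 4 * (2 * ‖G S.unit‖) * L ^ 3 * |t| ^ 3 := by gcongr
      _ = _ := by ring
  have hlin : T S.unit (v + w) + T S.unit (v - w) = (2 : ℝ) • T S.unit v := by
    rw [← hG.expansion_add hn hT, two_smul, ← hG.expansion_add hn hT]
    congr 1; abel
  have hlim := tendsto_diagonal_of_uniform_approx (D := fun t => Q (S.unit + t • v) w)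
    (F := fun s t => (2 * s ^ 2)⁻¹ • (G (S.unit + t • v + s • w)
      + G (S.unit + t • v + (-s) • w) - (2 : ℝ) • G (S.unit + t • v)))
    (K := 8 * ‖G S.unit‖ * L ^ 3) hδ ?_ ?_
  · rw [zero_smul, add_zero] at hlim
    have hlim' := tendsto_of_norm_sub_le
      (F := fun t => (2 * t ^ 2)⁻¹ • (G (S.unit + t • v + t • w)
        + G (S.unit + t • v + (-t) • w) - (2 : ℝ) • G (S.unit + t • v)))
      (y := (1 / 2 : ℝ) • (Q S.unit (v + w) + Q S.unit (v - w)) - Q S.unit v)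
      (K := 16 * ‖G S.unit‖ * L ^ 3) hδ ?_
    · have := tendsto_nhds_unique hlim hlim'
      rw [this]; module
    intro t ht htδ
    have htδ' : |t| < 1 / (2 * L + 1) := by rwa [abs_of_pos ht]
    have a₁ := second _ half_unit_mem v (by linarith [norm_nonneg w]) t htδ'
    have a₂ := second _ half_unit_mem (v + w) (norm_add_le v w) t htδ'
    have a₃ := second _ half_unit_mem (v - w) (norm_sub_le v w) t htδ'
    have e₁ : S.unit + t • v + t • w = S.unit + t • (v + w) := by module
    have e₂ : S.unit + t • v + (-t) • w = S.unit + t • (v - w) := by module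
    have e : (2 * t ^ 2)⁻¹ • (G (S.unit + t • (v + w)) + G (S.unit + t • (v - w))
          - (2 : ℝ) • G (S.unit + t • v))
        - ((1 / 2 : ℝ) • (Q S.unit (v + w) + Q S.unit (v - w)) - Q S.unit v)
        = (2 * t ^ 2)⁻¹ • ((G (S.unit + t • (v + w)) - G S.unit + t • T S.unit (v + w)
            - t ^ 2 • Q S.unit (v + w))
          + (G (S.unit + t • (v - w)) - G S.unit + t • T S.unit (v - w)
            - t ^ 2 • Q S.unit (v - w))
          - (2 : ℝ) • (G (S.unit + t • v) - G S.unit + t • T S.unit v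
            - t ^ 2 • Q S.unit v)) := by
      have hT' : T S.unit (v + w) = (2 : ℝ) • T S.unit v - T S.unit (v - w) := by
        rw [← hlin]; abel
      rw [hT']
      match_scalars <;> field_simp <;> ring
    have ht2 : 0 < 2 * t ^ 2 := by positivity
    rw [e₁, e₂, e, norm_smul, norm_inv, Real.norm_eq_abs, abs_of_pos ht2, inv_mul_le_iff₀ ht2]
    refine (norm_sub_le _ _).trans ?_
    refine (add_le_add (norm_add_le _ _) (norm_smul _ _).le).trans ?_
    rw [abs_of_pos ht] at a₁ a₂ a₃
    rw [Real.norm_eq_abs, abs_two]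
    linarith
  · intro s hs hsδ
    have hsδ₁ : |s| < 1 / (2 * L + 1) := by rwa [abs_of_pos hs]
    have hsδ₂ : |-s| < 1 / (2 * L + 1) := by rwa [abs_neg]
    have hw : ‖w‖ ≤ ‖v‖ + ‖w‖ := by linarith [norm_nonneg v]
    have c₁ := (hT _ hu v).hasDerivAt.continuousAt
    have hx₂ := mem_interiorCone_of_sub_half_mem (unit_add_smul_sub_mem_of_lt hn hw hsδ₁)
    have hx₃ := mem_interiorCone_of_sub_half_mem (unit_add_smul_sub_mem_of_lt hn hw hsδ₂)
    have c₂ := (hT _ hx₂ v).hasDerivAt.continuousAt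
    have c₃ := (hT _ hx₃ v).hasDerivAt.continuousAt
    refine ContinuousAt.const_smul ((ContinuousAt.add ?_ ?_).sub (c₁.const_smul _)) _
    · convert c₂ using 3; abel
    · convert c₃ using 3; abel
  · intro s t hs hsδ ht
    have hsδ₁ : |s| < 1 / (2 * L + 1) := by rwa [abs_of_pos hs]
    have hsδ₂ : |-s| < 1 / (2 * L + 1) := by rwa [abs_neg]
    have hw : ‖w‖ ≤ ‖v‖ + ‖w‖ := by linarith [norm_nonneg v]
    have hx := unit_add_smul_sub_mem_of_lt (y := v) hn (by linarith [norm_nonneg w]) ht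
    have a₁ := second _ hx w hw s hsδ₁
    have a₂ := second _ hx w hw (-s) hsδ₂
    generalize S.unit + t • v = x at *
    have e : Q x w - (2 * s ^ 2)⁻¹ • (G (x + s • w) + G (x + (-s) • w) - (2 : ℝ) • G x)
        = -((2 * s ^ 2)⁻¹ • ((G (x + s • w) - G x + s • T x w - s ^ 2 • Q x w)
          + (G (x + (-s) • w) - G x + (-s) • T x w - (-s) ^ 2 • Q x w))) := by
      match_scalars <;> field_simp <;> ring
    have hs2 : 0 < 2 * s ^ 2 := by positivity
    rw [e, norm_neg, norm_smul, norm_inv, Real.norm_eq_abs, abs_of_pos hs2, inv_mul_le_iff₀ hs2]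
    rw [abs_neg] at a₂
    rw [abs_of_pos hs] at a₁ a₂
    refine (norm_add_le _ _).trans ?_
    linarith

theorem expansion_smul (hT : ∀ v, S.IsExpansion G S.unit v (T S.unit v) (Q S.unit v))
    (c : ℝ) (v : E) : T S.unit (c • v) = c • T S.unit v := by
  have h₁ := (hT (c • v)).hasDerivAt
  have h₂ : HasDerivAt (fun t : ℝ => t * c) c 0 := by
    simpa using (hasDerivAt_id (0 : ℝ)).mul_const c
  have h₃ : HasDerivAt (fun t : ℝ => G (S.unit + t • v)) (-T S.unit v) (0 * c) := by
    rw [zero_mul]; exact (hT v).hasDerivAt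
  have h₄ := h₃.scomp (0 : ℝ) h₂
  have e : (fun t : ℝ => G (S.unit + t • v)) ∘ (fun t : ℝ => t * c)
      = fun t : ℝ => G (S.unit + t • c • v) := by
    funext t; simp [smul_smul]
  rw [e] at h₄
  have := h₁.unique h₄
  rw [smul_neg] at this
  exact neg_injective this

end Derivative

end OrderUnitSpace

namespace OrderUnitSpace

/-! ### The spectral square and the trace -/

section Square

variable {V : Type u} [AddCommGroup V] [Module ℝ V] (S : OrderUnitSpace V)

/-- The spectral square of `v`: if `v = M r + m s` with `u = r + s` and `r`, `s` on the boundary of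
the cone, this is `M² r + m² s`. -/
noncomputable def square (v : V) : V :=
  (S.upper S.unit v + S.lower S.unit v) • v - (S.upper S.unit v * S.lower S.unit v) • S.unit

/-- Half the sum of the two spectral values of `v`. -/
noncomputable def halfTrace (v : V) : ℝ := (S.upper S.unit v + S.lower S.unit v) / 2

theorem square_eq (v : V) : S.square v = (2 * S.halfTrace v) • v
    - (S.upper S.unit v * S.lower S.unit v) • S.unit := by
  rw [square, halfTrace]; congr 2; ring

end Square

/-- The derivative of `G` at the order unit is linear and injective and carries `square v` to half
the second derivative of `G` in the direction `v`, so `square` inherits the parallelogram law. -/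
theorem IsInversion.square_parallelogram {E : Type u} [NormedAddCommGroup E] [NormedSpace ℝ E]
    [Nontrivial E] {S : OrderUnitSpace E} {G : E → E} (hG : S.IsInversion G)
    (hS : S.StrictlyConvexCone) (hn : ∀ v : E, S.unitNorm v = ‖v‖) (v w : E) :
    S.square (v + w) + S.square (v - w) = (2 : ℝ) • S.square v + (2 : ℝ) • S.square w := by
  have hu := S.unit_mem_interiorCone
  have hex : ∀ x v : E, ∃ T Q : E, x ∈ S.interiorCone → S.IsExpansion G x v T Q := by
    intro x v
    by_cases hx : x ∈ S.interiorCone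
    · obtain ⟨T, Q, h⟩ := hG.exists_isExpansion hS hn hx v
      exact ⟨T, Q, fun _ => h⟩
    · exact ⟨0, 0, fun h => absurd h hx⟩
  choose T Q hTQ using hex
  have hT : ∀ x ∈ S.interiorCone, ∀ v, S.IsExpansion G x v (T x v) (Q x v) :=
    fun x hx v => hTQ x v hx
  have hsmul := fun c v => expansion_smul (hT _ hu) c v
  have hadd := hG.expansion_add hn hT
  have hsub : ∀ a b, T S.unit (a - b) = T S.unit a - T S.unit b := fun a b => by
    rw [eq_sub_iff_add_eq, ← hadd, sub_add_cancel]
  have hTu : T S.unit S.unit = G S.unit := by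
    have h₁ : S.upper S.unit S.unit = 1 := by
      simpa [S.upper_zero hu] using S.upper_add_smul hu 0 1
    have h₂ : S.lower S.unit S.unit = 1 := by
      simpa [lower, S.upper_zero hu] using S.lower_add_smul hu 0 1
    have := (hT _ hu S.unit).const (by rw [h₁, h₂])
    rwa [h₁, one_smul] at this
  have hsq : ∀ v, T S.unit (S.square v) = Q S.unit v := fun v => by
    rw [(hT _ hu v).quad, square, hsub, hsmul, hsmul, hTu]
  have h0 : T S.unit (S.square (v + w) + S.square (v - w)
      - ((2 : ℝ) • S.square v + (2 : ℝ) • S.square w)) = 0 := by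
    rw [hsub, hadd, hadd, hsmul, hsmul, hsq, hsq, hsq, hsq,
      hG.expansion_parallelogram hn hT, sub_self]
  exact sub_eq_zero.1 ((hT _ hu _).eq_zero h0)

variable {V : Type u} [AddCommGroup V] [Module ℝ V] (S : OrderUnitSpace V) [Nontrivial V]

theorem halfTrace_add_smul (v : V) (c : ℝ) :
    S.halfTrace (v + c • S.unit) = S.halfTrace v + c := by
  have hu := S.unit_mem_interiorCone
  rw [halfTrace, S.upper_add_smul hu, S.lower_add_smul hu, halfTrace]; ring

theorem halfTrace_zero : S.halfTrace (0 : V) = 0 := by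
  have hu := S.unit_mem_interiorCone
  simp [halfTrace, lower, S.upper_zero hu]

theorem halfTrace_smul (c : ℝ) (v : V) : S.halfTrace (c • v) = c * S.halfTrace v := by
  have hu := S.unit_mem_interiorCone
  have hpos : ∀ (c : ℝ) (v : V), 0 < c → S.halfTrace (c • v) = c * S.halfTrace v := by
    intro c v hc
    rw [halfTrace, S.upper_smul hu v hc, S.lower_smul hu v hc, halfTrace]; ring
  rcases lt_trichotomy c 0 with hc | rfl | hc
  · have e : c • v = (-c) • -v := by module
    rw [e, hpos _ _ (neg_pos.2 hc), halfTrace, S.upper_neg, S.lower_neg, halfTrace]; ring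
  · rw [zero_smul, S.halfTrace_zero, zero_mul]
  · exact hpos c v hc

theorem square_of_halfTrace_eq_zero {v : V} (h : S.halfTrace v = 0) :
    S.square v = (S.unitNorm v * S.unitNorm v) • S.unit := by
  have hle := S.lower_le_upper S.unit_mem_interiorCone v
  have hM : S.lower S.unit v = -S.upper S.unit v := by rw [halfTrace] at h; linarith
  rw [S.square_eq, h, S.unitNorm_eq_max, hM, neg_neg, max_self]; module

/-- If the spectral square satisfies the parallelogram law, then the half trace is additive:
compare the components of the law transverse to the order unit. -/
theorem halfTrace_add (hsq : ∀ v w : V, S.square (v + w) + S.square (v - w)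
    = (2 : ℝ) • S.square v + (2 : ℝ) • S.square w) (v w : V) :
    S.halfTrace (v + w) = S.halfTrace v + S.halfTrace w := by
  -- subtracting multiples of the order unit reduces to trace-free vectors
  have key : ∀ v w : V, S.halfTrace v = 0 → S.halfTrace w = 0 → S.halfTrace (v + w) = 0 := by
    intro v w hv hw
    have h := hsq v w
    rw [S.square_of_halfTrace_eq_zero hv, S.square_of_halfTrace_eq_zero hw, S.square_eq,
      S.square_eq] at h
    generalize S.upper S.unit (v + w) * S.lower S.unit (v + w) = p at h
    generalize S.upper S.unit (v - w) * S.lower S.unit (v - w) = q at h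
    set a := S.halfTrace (v + w) with ha
    set b := S.halfTrace (v - w) with hb
    obtain ⟨c, hc⟩ : ∃ c : ℝ, (a + b) • v + (a - b) • w = c • S.unit := by
      refine ⟨(p + q) / 2 + S.unitNorm v * S.unitNorm v + S.unitNorm w * S.unitNorm w, ?_⟩
      have e : (a + b) • v + (a - b) • w = (1 / 2 : ℝ) • ((2 * a) • (v + w) - p • S.unit
          + ((2 * b) • (v - w) - q • S.unit)) + ((p + q) / 2) • S.unit := by module
      rw [e, h]; module
    by_cases hab : a + b = 0
    · by_contra hne
      have hab' : a - b ≠ 0 := fun h' => hne (by linarith)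
      have e : w = 0 + ((a - b)⁻¹ * c) • S.unit := by
        rw [mul_smul, ← hc, hab, zero_smul, zero_add, zero_add, inv_smul_smul₀ hab']
      have hz : (a - b)⁻¹ * c = 0 := by
        rw [e, S.halfTrace_add_smul, S.halfTrace_zero, zero_add] at hw; exact hw
      rw [hz, zero_smul, zero_add] at e
      rw [ha, e, add_zero, hv] at hne
      exact hne rfl
    · have e : v = (-((a + b)⁻¹ * (a - b))) • w + ((a + b)⁻¹ * c) • S.unit := by
        rw [mul_smul (a + b)⁻¹ c, ← hc, smul_add, inv_smul_smul₀ hab]; module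
      have hz : (a + b)⁻¹ * c = 0 := by
        rw [e, S.halfTrace_add_smul, S.halfTrace_smul, hw, mul_zero, zero_add] at hv; exact hv
      rw [hz, zero_smul, add_zero] at e
      have e' : v + w = (1 - (a + b)⁻¹ * (a - b)) • w := by
        rw [sub_smul, one_smul, sub_eq_neg_add, ← neg_smul, ← e]
      rw [ha, e', S.halfTrace_smul, hw, mul_zero]
  have h := key (v + (-S.halfTrace v) • S.unit) (w + (-S.halfTrace w) • S.unit)
    (by rw [S.halfTrace_add_smul]; ring) (by rw [S.halfTrace_add_smul]; ring)
  have e : v + (-S.halfTrace v) • S.unit + (w + (-S.halfTrace w) • S.unit)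
    = v + w + (-S.halfTrace v - S.halfTrace w) • S.unit := by module
  rw [e, S.halfTrace_add_smul] at h
  linarith

end OrderUnitSpace

/-! ### Spin factors -/

section Spin

variable {H : Type u} [NormedAddCommGroup H] [InnerProductSpace ℝ H]

theorem exists_spinMul_self_iff {b : H × ℝ} : (∃ a, spinMul a a = b) ↔ ‖b.1‖ ≤ b.2 := by
  constructor
  · rintro ⟨⟨a, α⟩, rfl⟩
    simp only [spinMul, real_inner_self_eq_norm_mul_norm, ← two_smul ℝ (α • a), norm_smul,
      Real.norm_eq_abs, abs_two]
    nlinarith [sq_nonneg (|α| - ‖a‖), abs_mul_abs_self α]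
  · obtain ⟨b, β⟩ := b
    intro h
    simp only at h
    have hb := norm_nonneg b
    rcases eq_or_ne β 0 with rfl | hβ0
    · have : b = 0 := norm_le_zero_iff.1 h
      exact ⟨0, by simp [spinMul, this]⟩
    have hβ : 0 < β := lt_of_le_of_ne (hb.trans h) hβ0.symm
    -- the scalar part `α` of a square root solves `α² + ‖b‖² / (4 α²) = β`
    set d := √(β ^ 2 - ‖b‖ ^ 2) with hd
    have hd2 : d ^ 2 = β ^ 2 - ‖b‖ ^ 2 := Real.sq_sqrt (by nlinarith)
    have hd0 : 0 ≤ d := Real.sqrt_nonneg _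
    set α := √((β + d) / 2) with hα
    have hα2 : α ^ 2 = (β + d) / 2 := Real.sq_sqrt (by positivity)
    have hα0 : 0 < α := Real.sqrt_pos.2 (by positivity)
    refine ⟨((2 * α)⁻¹ • b, α), ?_⟩
    simp only [spinMul, Prod.mk.injEq]
    constructor
    · match_scalars; field_simp; norm_num
    · rw [real_inner_self_eq_norm_mul_norm, norm_smul, Real.norm_eq_abs,
        abs_of_pos (by positivity)]
      have : ‖b‖ ^ 2 = 4 * α ^ 2 * (β - α ^ 2) := by rw [hα2]; nlinarith
      field_simp
      rw [this]; ring

/-- The inverse `(α e - a) / (α² - ‖a‖²)` of `a + α e` in the spin factor. -/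
noncomputable def spinInv (x : H × ℝ) : H × ℝ := (x.2 ^ 2 - ‖x.1‖ ^ 2)⁻¹ • (-x.1, x.2)

theorem sq_sub_norm_sq_pos {H : Type*} [NormedAddCommGroup H] {x : H × ℝ}
    (hx : ‖x.1‖ < x.2) : 0 < x.2 ^ 2 - ‖x.1‖ ^ 2 := by
  nlinarith [norm_nonneg x.1]

theorem norm_spinInv_lt {x : H × ℝ} (hx : ‖x.1‖ < x.2) : ‖(spinInv x).1‖ < (spinInv x).2 := by
  have h := inv_pos.2 (sq_sub_norm_sq_pos hx)
  simp only [spinInv, Prod.smul_fst, Prod.smul_snd, smul_eq_mul, norm_smul, norm_neg,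
    Real.norm_eq_abs, abs_of_pos h]
  gcongr

theorem spinInv_spinInv {x : H × ℝ} (hx : ‖x.1‖ < x.2) : spinInv (spinInv x) = x := by
  obtain ⟨a, α⟩ := x
  have h := sq_sub_norm_sq_pos hx
  simp only at h
  have e : ((α ^ 2 - ‖a‖ ^ 2)⁻¹ * α) ^ 2 - ‖(α ^ 2 - ‖a‖ ^ 2)⁻¹ • -a‖ ^ 2
      = (α ^ 2 - ‖a‖ ^ 2)⁻¹ := by
    rw [norm_smul, norm_neg, mul_pow, mul_pow, Real.norm_eq_abs, sq_abs, ← mul_sub]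
    field_simp
  simp only [spinInv, Prod.smul_mk, smul_eq_mul, e, inv_inv, Prod.mk.injEq]
  constructor
  · rw [← smul_neg, neg_neg, smul_inv_smul₀ h.ne']
  · rw [mul_inv_cancel_left₀ h.ne']

theorem spinInv_smul {r : ℝ} (hr : 0 < r) (x : H × ℝ) : spinInv (r • x) = r⁻¹ • spinInv x := by
  have e : (r * x.2) ^ 2 - ‖r • x.1‖ ^ 2 = r ^ 2 * (x.2 ^ 2 - ‖x.1‖ ^ 2) := by
    rw [norm_smul, mul_pow, mul_pow, Real.norm_eq_abs, sq_abs, ← mul_sub]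
  simp only [spinInv, Prod.smul_fst, Prod.smul_snd, smul_eq_mul, e, ← smul_neg, mul_inv]
  rw [smul_smul]
  ext
  · simp only [Prod.smul_fst, smul_smul]; congr 1; field_simp
  · simp only [Prod.smul_snd, smul_eq_mul]; field_simp

/-- Inversion reverses the order of the cone `‖a‖ ≤ α`. With `q (a, α) = α² - ‖a‖²` one has
`q (x⁻¹ - y⁻¹) = q (y - x) / (q x * q y) ≥ 0`, so `x⁻¹ - y⁻¹` or its negative lies in the cone;
the sign is decided by pairing with `x`. -/
theorem norm_spinInv_sub_le {x y : H × ℝ} (hx : ‖x.1‖ < x.2) (hy : ‖y.1‖ < y.2)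
    (hxy : ‖y.1 - x.1‖ ≤ y.2 - x.2) :
    ‖(spinInv x).1 - (spinInv y).1‖ ≤ (spinInv x).2 - (spinInv y).2 := by
  have hqx := sq_sub_norm_sq_pos hx
  have hqy := sq_sub_norm_sq_pos hy
  obtain ⟨a, α⟩ := x
  obtain ⟨b, β⟩ := y
  simp only [spinInv, Prod.smul_fst, Prod.smul_snd, smul_eq_mul] at *
  set p := α ^ 2 - ‖a‖ ^ 2 with hp
  set q := β ^ 2 - ‖b‖ ^ 2 with hq
  set c := p⁻¹ • -a - q⁻¹ • -b with hc
  set γ := p⁻¹ * α - q⁻¹ * β with hγ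
  have hba : ‖b - a‖ ^ 2 = ‖b‖ ^ 2 - 2 * ⟪a, b⟫_ℝ + ‖a‖ ^ 2 := by
    rw [norm_sub_sq_real, real_inner_comm]
  have hquad : ‖c‖ ^ 2 ≤ γ ^ 2 := by
    have e : ‖c‖ ^ 2 = p⁻¹ ^ 2 * ‖a‖ ^ 2 - 2 * (p⁻¹ * q⁻¹ * ⟪a, b⟫_ℝ) + q⁻¹ ^ 2 * ‖b‖ ^ 2 := by
      rw [hc, norm_sub_sq_real, norm_smul, norm_smul, norm_neg, norm_neg, real_inner_smul_left,
        real_inner_smul_right, inner_neg_neg, mul_pow, mul_pow, Real.norm_eq_abs,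
        Real.norm_eq_abs, sq_abs, sq_abs]
      ring
    have e' : γ ^ 2 - ‖c‖ ^ 2 = p⁻¹ * q⁻¹ * ((β - α) ^ 2 - ‖b - a‖ ^ 2) := by
      have e₁ : γ ^ 2 - ‖c‖ ^ 2 = p⁻¹ ^ 2 * p + q⁻¹ ^ 2 * q
          - 2 * (p⁻¹ * q⁻¹ * (α * β - ⟪a, b⟫_ℝ)) := by
        rw [e, hγ, hp, hq]; ring
      have e₂ : (β - α) ^ 2 - ‖b - a‖ ^ 2 = p + q - 2 * (α * β - ⟪a, b⟫_ℝ) := by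
        rw [hba, hp, hq]; ring
      rw [e₁, e₂]; field_simp; ring
    have : 0 ≤ p⁻¹ * q⁻¹ * ((β - α) ^ 2 - ‖b - a‖ ^ 2) := by
      have := pow_le_pow_left₀ (norm_nonneg _) hxy 2
      exact mul_nonneg (by positivity) (by linarith)
    linarith
  have hpair : 0 ≤ α * γ + ⟪a, c⟫_ℝ := by
    have e : α * γ + ⟪a, c⟫_ℝ = q⁻¹ * (q - (α * β - ⟪a, b⟫_ℝ)) := by
      have e₁ : α * γ + ⟪a, c⟫_ℝ = p⁻¹ * p - q⁻¹ * (α * β - ⟪a, b⟫_ℝ) := by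
        rw [hγ, hc, hp, inner_sub_right, real_inner_smul_right, real_inner_smul_right,
          inner_neg_right, inner_neg_right, real_inner_self_eq_norm_sq]
        ring
      rw [e₁]; field_simp
    rw [e]
    refine mul_nonneg (by positivity) ?_
    have h₁ : ⟪b, b - a⟫_ℝ ≤ ‖b‖ * ‖b - a‖ := real_inner_le_norm _ _
    rw [inner_sub_right, real_inner_self_eq_norm_sq, real_inner_comm] at h₁
    have h₂ : ‖b‖ * ‖b - a‖ ≤ β * (β - α) :=
      mul_le_mul hy.le hxy (norm_nonneg _) ((norm_nonneg _).trans hy.le)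
    rw [hq]; nlinarith
  have hγ0 : 0 ≤ γ := by
    by_contra! hneg
    have h₁ := real_inner_le_norm a c
    have h₂ : ‖c‖ ≤ -γ :=
      (pow_le_pow_iff_left₀ (norm_nonneg c) (by linarith) two_ne_zero).1 (by rwa [neg_sq])
    have h₃ : ‖a‖ * ‖c‖ ≤ ‖a‖ * -γ := by gcongr
    nlinarith [norm_nonneg a]
  exact (pow_le_pow_iff_left₀ (norm_nonneg c) hγ0 two_ne_zero).1 hquad

end Spin

namespace OrderUnitSpace

variable {V : Type u} [AddCommGroup V] [Module ℝ V] {S : OrderUnitSpace V}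

/-! ### From the parallelogram law to the Hilbert space -/

theorem unitNorm_eq_add_abs_halfTrace [Nontrivial V] (v : V) :
    S.unitNorm v = S.unitNorm (v + (-S.halfTrace v) • S.unit) + |S.halfTrace v| := by
  have hu := S.unit_mem_interiorCone
  have hle := S.lower_le_upper hu v
  rw [S.unitNorm_eq_max, S.unitNorm_eq_max, S.upper_add_smul hu, S.lower_add_smul hu, halfTrace]
  generalize S.upper S.unit v = M at *
  generalize S.lower S.unit v = m at *
  rw [show -(m + -((M + m) / 2)) = M + -((M + m) / 2) by ring, max_self]
  rcases abs_cases ((M + m) / 2) with ⟨h, h'⟩ | ⟨h, h'⟩ <;>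
    rcases max_cases M (-m) with ⟨k, k'⟩ | ⟨k, k'⟩ <;> rw [h, k] <;> linarith

theorem mem_cone_iff_unitNorm_le_halfTrace [Nontrivial V] (v : V) :
    v ∈ S.cone ↔ S.unitNorm (v + (-S.halfTrace v) • S.unit) ≤ S.halfTrace v := by
  have hu := S.unit_mem_interiorCone
  have h := S.le_lower_iff hu (v := v) (c := 0)
  rw [zero_smul, sub_zero] at h
  rw [← h, S.unitNorm_eq_max, S.upper_add_smul hu, S.lower_add_smul hu, halfTrace]
  generalize S.upper S.unit v = M
  generalize S.lower S.unit v = m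
  rw [show -(m + -((M + m) / 2)) = M + -((M + m) / 2) by ring, max_self]
  constructor <;> intro h <;> linarith

/-- A complete order unit space whose spectral square satisfies the parallelogram law is a spin
factor: on the kernel of the half trace the square of `v` is `‖v‖² u`, so the order unit norm
comes from an inner product there. -/
theorem isSpinFactor_of_square_parallelogram [Nontrivial V] (hcomplete : S.IsComplete)
    (hdim : 3 ≤ Module.rank ℝ V)
    (hsq : ∀ v w : V, S.square (v + w) + S.square (v - w)
      = (2 : ℝ) • S.square v + (2 : ℝ) • S.square w) : S.IsSpinFactor := by
  let := S.normedAddCommGroup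
  let := S.normedSpace
  have hcs : CompleteSpace V := hcomplete
  have hu0 : S.unit ≠ 0 := fun h => S.zero_notMem_interiorCone (h ▸ S.unit_mem_interiorCone)
  let τ : V →ₗ[ℝ] ℝ :=
    { toFun := S.halfTrace
      map_add' := S.halfTrace_add hsq
      map_smul' := S.halfTrace_smul }
  let τc : V →L[ℝ] ℝ := τ.mkContinuous 1 fun v => by
    have h := S.unitNorm_eq_add_abs_halfTrace v
    have h' := S.unitNorm_nonneg (v + (-S.halfTrace v) • S.unit)
    have : |S.halfTrace v| ≤ S.unitNorm v := by linarith
    rw [one_mul]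
    exact this
  let H : Submodule ℝ V := LinearMap.ker τ
  have hclosed : IsClosed (H : Set V) := τc.isClosed_ker
  have hHc : CompleteSpace H := hclosed.completeSpace_coe
  have hpar : ∀ x y : H, ‖x + y‖ * ‖x + y‖ + ‖x - y‖ * ‖x - y‖
      = 2 * (‖x‖ * ‖x‖ + ‖y‖ * ‖y‖) := by
    intro x y
    have h0 : ∀ z : H, S.square (z : V) = (‖z‖ * ‖z‖) • S.unit := fun z =>
      S.square_of_halfTrace_eq_zero (LinearMap.mem_ker.1 z.2)
    have h := hsq (x : V) y
    rw [← Submodule.coe_add, ← Submodule.coe_sub, h0, h0, h0, h0, smul_smul, smul_smul, ← add_smul,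
      ← add_smul] at h
    rw [smul_left_injective ℝ hu0 h]; ring
  let ips : InnerProductSpace ℝ H := InnerProductSpace.ofNorm ℝ hpar
  have hτu : ∀ (v : V) (c : ℝ), τ (v + c • S.unit) = τ v + c := S.halfTrace_add_smul
  let T : V ≃ₗ[ℝ] H × ℝ :=
    { toFun := fun v => (⟨v + (-τ v) • S.unit, by
        rw [LinearMap.mem_ker, hτu]; ring⟩, τ v)
      invFun := fun p => (p.1 : V) + p.2 • S.unit
      map_add' := fun v w => by
        ext
        · simp only [map_add, Prod.fst_add, Submodule.coe_add]; module
        · simp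
      map_smul' := fun c v => by
        ext
        · simp only [map_smul, smul_eq_mul, RingHom.id_apply, Prod.smul_fst, Submodule.coe_smul]
          module
        · simp
      left_inv := fun v => by simp
      right_inv := fun p => by
        have hp : τ (p.1 : V) = 0 := LinearMap.mem_ker.1 p.1.2
        ext
        · simp only [hτu, hp]; module
        · simp only [hτu, hp]; ring }
  have hT₁ : ∀ v, ‖(T v).1‖ = S.unitNorm (v + (-S.halfTrace v) • S.unit) := fun v => rfl
  have hT₂ : ∀ v, (T v).2 = S.halfTrace v := fun v => rfl
  refine ⟨hdim, H, inferInstance, ips, hHc, T, ?_, fun v => ?_, ?_⟩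
  · have h1 : τ S.unit = 1 := by
      have := hτu 0 1
      simpa using this
    ext
    · change S.unit + (-τ S.unit) • S.unit = 0
      rw [h1]; module
    · exact h1
  · rw [spinNorm, hT₁, hT₂]
    exact S.unitNorm_eq_add_abs_halfTrace v
  · ext b
    rw [Set.mem_ofPred_eq, exists_spinMul_self_iff]
    constructor
    · rintro ⟨v, hv, rfl⟩
      rw [hT₁, hT₂]
      exact (S.mem_cone_iff_unitNorm_le_halfTrace v).1 hv
    · intro hb
      refine ⟨T.symm b, (S.mem_cone_iff_unitNorm_le_halfTrace _).2 ?_, T.apply_symm_apply b⟩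
      rw [← hT₁, ← hT₂, T.apply_symm_apply]
      exact hb

theorem isSpinFactor_of_antimorphism (hcomplete : S.IsComplete) (hconvex : S.StrictlyConvexCone)
    (hdim : 3 ≤ Module.rank ℝ V) {g : S.interiorCone → S.interiorCone} (hg : S.Antihomogeneous g)
    (hg' : S.OrderAntimorphism g) : S.IsSpinFactor := by
  have : Nontrivial V := by
    rw [← rank_pos_iff_nontrivial (R := ℝ)]
    exact lt_of_lt_of_le (by norm_num) hdim
  classical
  let G : V → V := fun x => if h : x ∈ S.interiorCone then g ⟨x, h⟩ else 0
  have hGg : ∀ x (h : x ∈ S.interiorCone), G x = g ⟨x, h⟩ := fun x h => dif_pos h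
  have hG : S.IsInversion G :=
    { mapsTo := fun x hx => by rw [hGg x hx]; exact (g ⟨x, hx⟩).2
      map_smul := fun r hr x hx => by
        rw [hGg x hx, hGg _ (S.smul_mem_interiorCone hr hx)]; exact hg r hr ⟨x, hx⟩
      sub_mem_iff := fun x hx y hy => by
        rw [hGg x hx, hGg y hy]; exact hg' ⟨x, hx⟩ ⟨y, hy⟩ }
  refine isSpinFactor_of_square_parallelogram hcomplete hdim ?_
  exact @IsInversion.square_parallelogram V S.normedAddCommGroup S.normedSpace _ S G hG hconvex
    fun _ => rfl

/-- A spin factor carries an antihomogeneous order-antimorphism, namely the Jordan inverse. -/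
theorem IsSpinFactor.exists_antimorphism (h : S.IsSpinFactor) :
    ∃ g : S.interiorCone → S.interiorCone,
      Function.Bijective g ∧ S.Antihomogeneous g ∧ S.OrderAntimorphism g := by
  obtain ⟨-, H, _, _, _, T, hTu, -, hTC⟩ := h
  have hC : ∀ x : V, x ∈ S.cone ↔ ‖(T x).1‖ ≤ (T x).2 := by
    intro x
    have h₁ : T x ∈ T '' (S.cone : Set V) ↔ x ∈ S.cone := by
      rw [T.injective.mem_set_image]; rfl
    rw [← h₁, hTC, Set.mem_ofPred_eq, exists_spinMul_self_iff]
  have hI : ∀ x : V, x ∈ S.interiorCone ↔ ‖(T x).1‖ < (T x).2 := by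
    intro x
    have e : ∀ ε : ℝ, x - ε • S.unit ∈ S.cone ↔ ‖(T x).1‖ ≤ (T x).2 - ε := fun ε => by
      rw [hC, map_sub, map_smul, hTu]; simp
    rw [S.mem_interiorCone_iff]
    simp only [e]
    constructor
    · rintro ⟨ε, hε, h⟩; linarith
    · exact fun h => ⟨(T x).2 - ‖(T x).1‖, by linarith, by linarith⟩
  let g : S.interiorCone → S.interiorCone := fun x =>
    ⟨T.symm (spinInv (T x)), (hI _).2 (by
      rw [T.apply_symm_apply]; exact norm_spinInv_lt ((hI x).1 x.2))⟩
  have hTg : ∀ x, T (g x : V) = spinInv (T x) := fun x => T.apply_symm_apply _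
  have hgg : Function.Involutive g := fun x => by
    apply Subtype.ext
    apply T.injective
    rw [hTg, hTg, spinInv_spinInv ((hI x).1 x.2)]
  have hanti : ∀ x y : S.interiorCone, S.LE (x : V) y → S.LE (g y : V) (g x) := by
    intro x y hxy
    rw [LE, hC, map_sub] at hxy ⊢
    rw [hTg, hTg]
    exact norm_spinInv_sub_le ((hI x).1 x.2) ((hI y).1 y.2) hxy
  refine ⟨g, hgg.bijective, fun r hr x => ?_, fun x y => ⟨hanti x y, fun h => ?_⟩⟩
  · apply T.injective
    rw [hTg, map_smul, map_smul, hTg, spinInv_smul hr]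
  · have := hanti _ _ h
    rwa [hgg x, hgg y] at this

end OrderUnitSpace

theorem theorem1p1 {V : Type u} [AddCommGroup V] [Module ℝ V] (S : OrderUnitSpace V)
    (hcomplete : S.IsComplete) (hconvex : S.StrictlyConvexCone) (hdim : 3 ≤ Module.rank ℝ V) :
    (∃ g : S.interiorCone → S.interiorCone,
      Function.Bijective g ∧ S.Antihomogeneous g ∧ S.OrderAntimorphism g) ↔ S.IsSpinFactor :=
  ⟨fun ⟨_, _, hg, hg'⟩ => OrderUnitSpace.isSpinFactor_of_antimorphism hcomplete hconvex hdim hg hg',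
    OrderUnitSpace.IsSpinFactor.exists_antimorphism⟩
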